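/- Let $d \ge 1$, let $H=(H_1,\dots,H_d)\in(0,1)^d$ and $\bar H=(H_1+\cdots+H_d)/d$. Let $W^H=(W^H_t)_{t\in[0,1]^d}$ be a fractional Brownian sheet of Hurst multiparameter $H$ on a probability space, i.e. a centered Gaussian process with $$\mathbb E(W^H_tW^H_{t'})=\prod_{i=1}^d\frac{|t_i|^{2H_i}+|t'_i|^{2H_i}-|t_i-t'_i|^{2H_i}}{2},\qquad t,t'\in[0,1]^d,$$ with almost surely continuous sample paths. Definitions. For $u \in L^1(\mathbb R^d)$, $\|Du\|(\mathbb R^d)$ is the supremum of $\int u\,\mathrm{div}\,v$ over all $v\in C^1_c(\mathbb R^d;\mathbb R^d)$ with $|v|\le 1$. $BV([0,1]^d)$ is the space of all $u\in L^1(\mathbb R^d)$ that vanish a.e. outside $[0,1]^d$ and have $\|Du\|(\mathbb R^d)<\infty$, with the norm $\|u\|_1+\|Du\|(\mathbb R^d)$. A $BV$-subset of $[0,1]^d$ is a measurable set $B\subset[0,1]^d$ with $\mathbf 1_B\in BV([0,1]^d)$; its perimeter is $\|B\|=\|D\mathbf 1_B\|(\mathbb R^d)$. A charge is a real function $\mu$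 of the $BV$-subsets of $[0,1]^d$ such that $\mu(B_1\cup B_2)=\mu(B_1)+\mu(B_2)$ whenever $|B_1\cap B_2|=0$, and $\mu(B_n)\to\mu(B)$ whenever $\sup_n\|B_n\|<\infty$ and $|B_n\triangle B|\to0$. A strong charge is a charge of the form $\mu(B)=\alpha(\mathbf 1_B)$, where $\alpha$ belongs to the closure in $BV([0,1]^d)^*$ (for the operator norm) of the set of functionals $u\mapsto\int_{[0,1]^d}fu$ with $f\in L^d([0,1]^d)$. Let $f$ be in $C_0([0,1]^d)$, i.e. continuous on $[0,1]^d$ with $f(x)=0$ whenever some $x_i=0$. Its increment on a nondegenerate rectangle is $$\Delta_f\Big(\prod_{i=1}^d[a_i,b_i]\Big)=\sum_{c\in\prod_i\{a_i,b_i\}}(-1)^{\#\{i:\,c_i=a_i\}}f(c),$$ and $\Delta_f$ is extended additively to figures, i.e. finite unions of pairwise almost disjoint rectangles in $[0,1]^d$. The function $f$ is strongly chargeable if $\Delta_f$ extends to a strong charge. A strong charge $\mu$ is $\gamma$-Hölder if there is $C\ge0$ with $|\mu(K)|\le C|K|^\gamma$ for all dyadic cubes $K=\prod_i[2^{-n}k_i,2^{-n}(k_i+1)]\subset[0,1]^d$.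 Theorem. If $\bar H>\frac{d-1}{d}$, then almost surely the sample path $t\mapsto W^H_t$ belongs to $C_0([0,1]^d)$ and is strongly chargeable: its increment function extends to a strong charge which is $\gamma$-Hölder for every $0<\gamma<\bar H$. -/

import Mathlib

open MeasureTheory ProbabilityTheory
open scoped ENNReal Topology

noncomputable section

namespace FBS

/-- The unit cube `[0,1]^d`. -/
abbrev cube (d : ℕ) : Set (Fin d → ℝ) := Set.Icc 0 1

/-! ### Functions of bounded variation -/

/-- The divergence of a vector field on `ℝ^d`. -/
def divergence {d : ℕ} (v : (Fin d → ℝ) → EuclideanSpace ℝ (Fin d)) (x : Fin d → ℝ) : ℝ :=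
  ∑ i, fderiv ℝ v x (Pi.single i 1) i

/-- Compactly supported `C¹` vector fields on `ℝ^d` whose Euclidean norm is at most `1`. -/
structure IsTestField {d : ℕ} (v : (Fin d → ℝ) → EuclideanSpace ℝ (Fin d)) : Prop where
  contDiff : ContDiff ℝ 1 v
  hasCompactSupport : HasCompactSupport v
  norm_le_one : ∀ x, ‖v x‖ ≤ 1

/-- The variation `‖Du‖(ℝ^d)` of an integrable function `u`. -/
def variation {d : ℕ} (u : (Fin d → ℝ) → ℝ) : ℝ≥0∞ :=
  ⨆ (v : (Fin d → ℝ) → EuclideanSpace ℝ (Fin d)) (_ : IsTestField v),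
    ENNReal.ofReal (∫ x, u x * divergence v x)

theorem IsTestField.continuous_divergence {d : ℕ} {v : (Fin d → ℝ) → EuclideanSpace ℝ (Fin d)}
    (hv : IsTestField v) : Continuous (divergence v) := by
  unfold divergence
  refine continuous_finsetSum _ fun i _ => ?_
  have h := hv.contDiff.continuous_fderiv (by norm_num)
  have h2 : Continuous fun x => fderiv ℝ v x (Pi.single i 1) := h.clm_apply continuous_const
  exact (EuclideanSpace.proj (𝕜 := ℝ) i).continuous.comp h2

theorem IsTestField.integrable_mul {d : ℕ} {v : (Fin d → ℝ) → EuclideanSpace ℝ (Fin d)}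
    (hv : IsTestField v) {u : (Fin d → ℝ) → ℝ} (hu : Integrable u) :
    Integrable (fun x => u x * divergence v x) := by
  have hc : HasCompactSupport (divergence v) := by
    refine (hv.hasCompactSupport.fderiv (𝕜 := ℝ)).mono fun x hx => ?_
    contrapose! hx
    simp only [Function.mem_support, not_not] at hx ⊢
    simp [divergence, hx]
  obtain ⟨C, hC⟩ := hc.exists_bound_of_continuous hv.continuous_divergence
  exact hu.mul_bdd hv.continuous_divergence.aestronglyMeasurable (ae_of_all _ hC)

theorem variation_congr {d : ℕ} {u w : (Fin d → ℝ) → ℝ} (h : u =ᵐ[volume] w) :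
    variation u = variation w := by
  unfold variation
  refine iSup_congr fun v => iSup_congr fun _ => ?_
  congr 1
  exact integral_congr_ae (h.mono fun x hx => by simp [hx])

theorem variation_zero {d : ℕ} : variation (0 : (Fin d → ℝ) → ℝ) = 0 := by
  simp [variation]

theorem variation_add_le {d : ℕ} {u w : (Fin d → ℝ) → ℝ} (hu : Integrable u)
    (hw : Integrable w) : variation (u + w) ≤ variation u + variation w := by
  refine iSup₂_le fun v hv => ?_
  have : ∫ x, (u + w) x * divergence v x
      = (∫ x, u x * divergence v x) + ∫ x, w x * divergence v x := by
    rw [← integral_add (hv.integrable_mul hu) (hv.integrable_mul hw)]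
    simp [add_mul]
  rw [this]
  refine ENNReal.ofReal_add_le.trans (add_le_add ?_ ?_)
  · exact le_iSup₂ (f := fun v (_ : IsTestField v) =>
      ENNReal.ofReal (∫ x, u x * divergence v x)) v hv
  · exact le_iSup₂ (f := fun v (_ : IsTestField v) =>
      ENNReal.ofReal (∫ x, w x * divergence v x)) v hv

theorem IsTestField.neg {d : ℕ} {v : (Fin d → ℝ) → EuclideanSpace ℝ (Fin d)}
    (hv : IsTestField v) : IsTestField (-v) :=
  ⟨hv.contDiff.neg, hv.hasCompactSupport.neg, fun x => by simpa using hv.norm_le_one x⟩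

theorem divergence_neg {d : ℕ} (v : (Fin d → ℝ) → EuclideanSpace ℝ (Fin d)) (x : Fin d → ℝ) :
    divergence (-v) x = -divergence v x := by
  simp [divergence, fderiv_neg]

theorem variation_smul_le {d : ℕ} (c : ℝ) (u : (Fin d → ℝ) → ℝ) :
    variation (c • u) ≤ ENNReal.ofReal |c| * variation u := by
  refine iSup₂_le fun v hv => ?_
  have key : ∀ w : (Fin d → ℝ) → EuclideanSpace ℝ (Fin d), IsTestField w →
      ENNReal.ofReal (|c| * ∫ x, u x * divergence w x) ≤ ENNReal.ofReal |c| * variation u := by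
    intro w hw
    rw [ENNReal.ofReal_mul (abs_nonneg c)]
    gcongr
    exact le_iSup₂ (f := fun v (_ : IsTestField v) =>
      ENNReal.ofReal (∫ x, u x * divergence v x)) w hw
  have h1 : ∫ x, (c • u) x * divergence v x = c * ∫ x, u x * divergence v x := by
    rw [← integral_const_mul]
    simp [mul_assoc]
  rw [h1]
  rcases le_total 0 c with hc | hc
  · simpa [abs_of_nonneg hc] using key v hv
  · have := key (-v) hv.neg
    simpa [abs_of_nonpos hc, divergence_neg, integral_neg] using this

/-- The functions in `BV(ℝ^d)` that vanish almost everywhere outside `[0,1]^d`, as a subspace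
of `L¹(ℝ^d)`. -/
def bvSubmodule (d : ℕ) : Submodule ℝ (Lp ℝ 1 (volume : Measure (Fin d → ℝ))) where
  carrier := {u | variation u < ∞ ∧ ∀ᵐ x, x ∉ cube d → u x = 0}
  zero_mem' := by
    refine ⟨?_, ?_⟩
    · rw [variation_congr (Lp.coeFn_zero ℝ 1 volume), variation_zero]
      exact ENNReal.zero_lt_top
    · filter_upwards [Lp.coeFn_zero ℝ 1 (volume : Measure (Fin d → ℝ))] with x hx _
      rw [hx, Pi.zero_apply]
  add_mem' := by
    rintro u w ⟨hu, hu'⟩ ⟨hw, hw'⟩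
    refine ⟨?_, ?_⟩
    · rw [variation_congr (Lp.coeFn_add u w)]
      exact (variation_add_le (L1.integrable_coeFn u) (L1.integrable_coeFn w)).trans_lt
        (ENNReal.add_lt_top.2 ⟨hu, hw⟩)
    · filter_upwards [Lp.coeFn_add u w, hu', hw'] with x hx h1 h2 hxc
      rw [hx, Pi.add_apply, h1 hxc, h2 hxc, add_zero]
  smul_mem' := by
    rintro c u ⟨hu, hu'⟩
    refine ⟨?_, ?_⟩
    · rw [variation_congr (Lp.coeFn_smul c u)]
      exact (variation_smul_le c u).trans_lt (ENNReal.mul_lt_top ENNReal.ofReal_lt_top hu)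
    · filter_upwards [Lp.coeFn_smul c u, hu'] with x hx h1 hxc
      rw [hx, Pi.smul_apply, h1 hxc, smul_zero]

/-- The space `BV([0,1]^d)`; a type synonym, so that it carries the norm `‖u‖₁ + ‖Du‖(ℝ^d)`
instead of the norm of `L¹`. -/
def BVCube (d : ℕ) : Type := bvSubmodule d

namespace BVCube

variable {d : ℕ}

instance : AddCommGroup (BVCube d) := inferInstanceAs (AddCommGroup (bvSubmodule d))

instance : Module ℝ (BVCube d) := inferInstanceAs (Module ℝ (bvSubmodule d))

/-- The inclusion of `BV([0,1]^d)` into `L¹(ℝ^d)`. -/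
def toL1 : BVCube d →ₗ[ℝ] Lp ℝ 1 (volume : Measure (Fin d → ℝ)) := (bvSubmodule d).subtype

instance : CoeFun (BVCube d) (fun _ => (Fin d → ℝ) → ℝ) := ⟨fun u => (toL1 u : (Fin d → ℝ) → ℝ)⟩

theorem variation_lt_top (u : BVCube d) : variation u < ∞ := u.2.1

/-- The norm `‖u‖_BV = ‖u‖₁ + ‖Du‖(ℝ^d)`. -/
instance : Norm (BVCube d) := ⟨fun u => (∫ x, |u x|) + (variation u).toReal⟩

theorem norm_def (u : BVCube d) : ‖u‖ = (∫ x, |u x|) + (variation u).toReal := rfl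

theorem norm_eq (u : BVCube d) : ‖u‖ = ‖toL1 u‖ + (variation u).toReal := by
  rw [norm_def, L1.norm_eq_integral_norm]
  rfl

theorem normedSpaceCore : NormedSpace.Core ℝ (BVCube d) where
  norm_nonneg u := by
    rw [norm_eq]
    positivity
  norm_smul c u := by
    have h1 : ∀ (c : ℝ) (u : BVCube d),
        (variation (c • u : BVCube d)).toReal ≤ |c| * (variation u).toReal := by
      intro c u
      have : variation (c • u : BVCube d) ≤ ENNReal.ofReal |c| * variation u := by
        rw [map_smul, variation_congr (Lp.coeFn_smul c (toL1 u))]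
        exact variation_smul_le c _
      have h := ENNReal.toReal_mono
        (ENNReal.mul_lt_top ENNReal.ofReal_lt_top u.variation_lt_top).ne this
      simpa [ENNReal.toReal_mul] using h
    have h2 : (variation (c • u : BVCube d)).toReal = |c| * (variation u).toReal := by
      refine le_antisymm (h1 c u) ?_
      rcases eq_or_ne c 0 with rfl | hc
      · simp
      · have := h1 c⁻¹ (c • u)
        rw [inv_smul_smul₀ hc, abs_inv] at this
        have hc' : 0 < |c| := abs_pos.2 hc
        rwa [le_inv_mul_iff₀ hc'] at this
    rw [norm_eq, norm_eq, h2, map_smul, norm_smul, Real.norm_eq_abs]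
    ring
  norm_triangle u w := by
    have h : variation (u + w : BVCube d) ≤ variation u + variation w := by
      rw [map_add, variation_congr (Lp.coeFn_add (toL1 u) (toL1 w))]
      exact variation_add_le (L1.integrable_coeFn _) (L1.integrable_coeFn _)
    have h' := ENNReal.toReal_mono
      (ENNReal.add_lt_top.2 ⟨u.variation_lt_top, w.variation_lt_top⟩).ne h
    rw [ENNReal.toReal_add u.variation_lt_top.ne w.variation_lt_top.ne] at h'
    have := norm_add_le (toL1 u) (toL1 w)
    rw [norm_eq, norm_eq, norm_eq, map_add] at *
    linarith
  norm_eq_zero_iff u := by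
    constructor
    · intro h
      rw [norm_eq] at h
      have h0 : ‖toL1 u‖ = 0 :=
        le_antisymm (by linarith [(ENNReal.toReal_nonneg : 0 ≤ (variation u).toReal)])
          (norm_nonneg _)
      exact Subtype.ext (norm_eq_zero.1 h0)
    · rintro rfl
      rw [norm_eq, map_zero, variation_congr (Lp.coeFn_zero ℝ 1 volume), variation_zero]
      simp

instance : NormedAddCommGroup (BVCube d) := NormedAddCommGroup.ofCore normedSpaceCore

instance : NormedSpace ℝ (BVCube d) := NormedSpace.ofCore normedSpaceCore

end BVCube

/-! ### `BV`-sets -/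

/-- The perimeter `‖A‖ = ‖D 1_A‖(ℝ^d)`. -/
def perimeter {d : ℕ} (A : Set (Fin d → ℝ)) : ℝ≥0∞ :=
  variation (A.indicator fun _ => (1 : ℝ))

/-- The `BV`-subsets of `[0,1]^d`: Lebesgue measurable subsets of finite perimeter. -/
structure BVSet (d : ℕ) where
  carrier : Set (Fin d → ℝ)
  subset_cube : carrier ⊆ cube d
  nullMeasurable : NullMeasurableSet carrier
  perimeter_lt_top : perimeter carrier < ∞

namespace BVSet

variable {d : ℕ}

theorem integrable_indicator (B : BVSet d) :
    Integrable (B.carrier.indicator fun _ => (1 : ℝ)) := by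
  refine IntegrableOn.integrable_indicator₀ (integrableOn_const ?_) B.nullMeasurable
  exact ((measure_mono B.subset_cube).trans_lt isCompact_Icc.measure_lt_top).ne

/-- The indicator function of a `BV`-subset of `[0,1]^d`, as an element of `BV([0,1]^d)`. -/
def ind (B : BVSet d) : BVCube d :=
  ⟨B.integrable_indicator.toL1 _, by
    have h := B.integrable_indicator.coeFn_toL1
    refine ⟨?_, ?_⟩
    · rw [variation_congr h]
      exact B.perimeter_lt_top
    · filter_upwards [h] with x hx hxc
      rw [hx]
      exact Set.indicator_of_notMem (fun hB => hxc (B.subset_cube hB)) _⟩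

end BVSet

section Rectangles

open Set

/-- Rectangles have finite perimeter. -/
theorem perimeter_Icc_lt_top {d : ℕ} (a b : Fin d → ℝ) (hab : a ≤ b) :
    perimeter (Icc a b) < ∞ := by
  cases d with
  | zero => simp [perimeter, variation, divergence]
  | succ n =>
    refine lt_of_le_of_lt (b := ENNReal.ofReal (∑ i : Fin (n+1),
      2 * (volume (Icc (a ∘ i.succAbove) (b ∘ i.succAbove))).toReal)) ?_ ENNReal.ofReal_lt_top
    refine iSup₂_le fun v hv => ENNReal.ofReal_le_ofReal ?_
    have h1 : ∫ x, (Icc a b).indicator (fun _ => (1:ℝ)) x * divergence v x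
        = ∫ x in Icc a b, ∑ i,
          ((EuclideanSpace.proj (𝕜 := ℝ) i).comp (fderiv ℝ v x)) (Pi.single i 1) := by
      rw [← integral_indicator measurableSet_Icc]
      congr 1; ext x
      by_cases hx : x ∈ Icc a b <;> simp [hx, divergence]
    have hd : ∀ x, HasFDerivAt v (fderiv ℝ v x) x := fun x =>
      ((hv.contDiff.differentiable (by norm_num)) x).hasFDerivAt
    rw [h1, integral_divergence_of_hasFDerivAt_off_countable' a b hab (fun i x => v x i)
      (fun i x => (EuclideanSpace.proj (𝕜 := ℝ) i).comp (fderiv ℝ v x)) ∅ countable_empty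
      (fun i => ((EuclideanSpace.proj (𝕜 := ℝ) i).continuous.comp hv.contDiff.continuous).continuousOn)
      (fun x _ i => (EuclideanSpace.proj (𝕜 := ℝ) i).hasFDerivAt.comp x (hd x))
      (by
        have : (fun x => ∑ i, ((EuclideanSpace.proj (𝕜 := ℝ) i).comp (fderiv ℝ v x)) (Pi.single i 1)) = divergence v := by
          ext x; simp [divergence]
        rw [this]; exact hv.continuous_divergence.continuousOn.integrableOn_compact isCompact_Icc)]
    refine Finset.sum_le_sum fun i _ => ?_
    have hb : ∀ y, ‖v y i‖ ≤ 1 := fun y => (PiLp.norm_apply_le (v y) i).trans (hv.norm_le_one y)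
    have hf : ∀ g : (Fin n → ℝ) → Fin (n+1) → ℝ,
        |∫ x in Icc (a ∘ i.succAbove) (b ∘ i.succAbove), v (g x) i| ≤
          (volume (Icc (a ∘ i.succAbove) (b ∘ i.succAbove))).toReal := fun g => by
      have := norm_setIntegral_le_of_norm_le_const (μ := volume)
        (s := Icc (a ∘ i.succAbove) (b ∘ i.succAbove)) (f := fun x => v (g x) i) (C := 1)
        isCompact_Icc.measure_lt_top (fun x _ => hb _)
      simpa [Measure.real] using this
    have e1 := abs_le.1 (hf (i.insertNth (α := fun _ => ℝ) (b i)))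
    have e2 := abs_le.1 (hf (i.insertNth (α := fun _ => ℝ) (a i)))
    linarith [e1.2, e2.1]

/-- Finite unions of pairwise almost disjoint rectangles in `[0,1]^d` are `BV`-sets. -/
theorem exists_bvSet_iUnion_Icc {d m : ℕ} (a b : Fin m → cube d)
    (hab : ∀ j, a j ≤ b j)
    (hdisj : ∀ j k, j ≠ k → volume (Set.Icc (a j : Fin d → ℝ) (b j) ∩ Set.Icc (a k) (b k)) = 0) :
    ∃ F : BVSet d, F.carrier = ⋃ j, Set.Icc (a j : Fin d → ℝ) (b j) := by
  have hint : ∀ j, Integrable ((Icc (a j : Fin d → ℝ) (b j)).indicator fun _ => (1 : ℝ)) := fun j =>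
    IntegrableOn.integrable_indicator (integrableOn_const isCompact_Icc.measure_lt_top.ne)
      measurableSet_Icc
  have hsum : ∀ s : Finset (Fin m), Integrable
      (∑ j ∈ s, (Icc (a j : Fin d → ℝ) (b j)).indicator fun _ => (1 : ℝ)) ∧
      variation (∑ j ∈ s, (Icc (a j : Fin d → ℝ) (b j)).indicator fun _ => (1 : ℝ)) < ∞ := by
    intro s
    induction s using Finset.cons_induction with
    | empty => simp [variation_zero]
    | cons j s hj ih =>
      rw [Finset.sum_cons]
      exact ⟨(hint j).add ih.1, (variation_add_le (hint j) ih.1).trans_lt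
        (ENNReal.add_lt_top.2 ⟨perimeter_Icc_lt_top _ _ (hab j), ih.2⟩)⟩
  refine ⟨⟨_, iUnion_subset fun j => Icc_subset_Icc (a j).2.1 (b j).2.2,
    (MeasurableSet.iUnion fun j => measurableSet_Icc).nullMeasurableSet, ?_⟩, rfl⟩
  rw [perimeter, variation_congr (w := ∑ j, (Icc (a j : Fin d → ℝ) (b j)).indicator fun _ => (1 : ℝ))]
  · exact (hsum _).2
  · have : ∀ᵐ x, ∀ j k, j ≠ k → x ∉ Set.Icc (a j : Fin d → ℝ) (b j) ∩ Set.Icc (a k) (b k) := by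
      simp only [ae_all_iff]
      exact fun j k h => measure_eq_zero_iff_ae_notMem.1 (hdisj j k h)
    filter_upwards [this] with x hx
    rw [Finset.sum_apply]
    by_cases hU : x ∈ ⋃ j, Icc (a j : Fin d → ℝ) (b j)
    · obtain ⟨j, hj⟩ := mem_iUnion.1 hU
      rw [indicator_of_mem hU, Finset.sum_eq_single j, indicator_of_mem hj]
      · exact fun k _ hk => indicator_of_notMem (fun h => hx k j hk ⟨h, hj⟩) _
      · simp
    · rw [indicator_of_notMem hU, Finset.sum_eq_zero]
      exact fun j _ => indicator_of_notMem (fun h => hU (mem_iUnion.2 ⟨j, h⟩)) _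

end Rectangles

/-! ### Charges and strong charges -/

/-- `μ` is a charge on `[0,1]^d`: it is finitely additive, and continuous with respect to
`BV`-convergence. -/
structure IsCharge {d : ℕ} (μ : BVSet d → ℝ) : Prop where
  additive : ∀ B₁ B₂ B : BVSet d, volume (B₁.carrier ∩ B₂.carrier) = 0 →
    B.carrier = B₁.carrier ∪ B₂.carrier → μ B = μ B₁ + μ B₂
  tendsto : ∀ (B : ℕ → BVSet d) (B' : BVSet d),
    (⨆ n, perimeter (B n).carrier) < ∞ →
    Filter.Tendsto (fun n => volume (symmDiff (B n).carrier B'.carrier)) Filter.atTop (𝓝 0) →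
    Filter.Tendsto (fun n => μ (B n)) Filter.atTop (𝓝 (μ B'))

/-- The space `SCH([0,1]^d)` of strong charge functionals: the closure, in the dual Banach space
of `BV([0,1]^d)`, of the functionals `T_f : u ↦ ∫_{[0,1]^d} f u` with `f ∈ L^d([0,1]^d)`. -/
def SCH (d : ℕ) : Set (StrongDual ℝ (BVCube d)) :=
  closure {α | ∃ f : (Fin d → ℝ) → ℝ, MemLp f d (volume.restrict (cube d)) ∧
    ∀ u : BVCube d, α u = ∫ x in cube d, f x * u x}

/-- `μ` is a strong charge: a charge of the form `B ↦ α(1_B)` with `α ∈ SCH([0,1]^d)`. -/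
structure IsStrongCharge {d : ℕ} (μ : BVSet d → ℝ) : Prop where
  isCharge : IsCharge μ
  exists_functional : ∃ α ∈ SCH d, ∀ B : BVSet d, μ B = α B.ind

/-- The vertex of the rectangle `∏ [a_i, b_i]` whose `i`-th coordinate is `a_i` for `i ∈ s` and
`b_i` for `i ∉ s`. -/
def vertex {d : ℕ} (a b : cube d) (s : Finset (Fin d)) : cube d :=
  ⟨s.piecewise a b, s.piecewise_mem_Icc_of_mem_of_mem a.2 b.2⟩

/-- The increment `Δ_f` on the rectangle `∏ [a_i, b_i]`: the sum of the values of `f` at the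
vertices, with the sign `(-1)` to the number of coordinates equal to `a_i`. -/
def increment {d : ℕ} (f : cube d → ℝ) (a b : cube d) : ℝ :=
  ∑ s : Finset (Fin d), (-1) ^ s.card * f (vertex a b s)

/-- `μ` extends the finitely additive function `Δ_f` on figures: if a figure `F` is written as a
finite union of pairwise almost disjoint nondegenerate rectangles, then `μ(F)` is the sum of the
increments of `f` on these rectangles. -/
def ExtendsIncrement {d : ℕ} (f : cube d → ℝ) (μ : BVSet d → ℝ) : Prop :=
  ∀ (m : ℕ) (a b : Fin m → cube d),
    (∀ j i, (a j : Fin d → ℝ) i < (b j : Fin d → ℝ) i) →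
    (∀ j k, j ≠ k → volume (Set.Icc (a j : Fin d → ℝ) (b j) ∩ Set.Icc (a k) (b k)) = 0) →
    ∀ F : BVSet d, F.carrier = ⋃ j, Set.Icc (a j : Fin d → ℝ) (b j) →
      μ F = ∑ j, increment f (a j) (b j)

/-- The space `C_0([0,1]^d)`: continuous functions that vanish where some coordinate is `0`. -/
def IsC0 {d : ℕ} (f : cube d → ℝ) : Prop :=
  Continuous f ∧ ∀ x : cube d, (∃ i, (x : Fin d → ℝ) i = 0) → f x = 0

/-- The dyadic cubes `∏ [2^{-n} k_i, 2^{-n} (k_i + 1)]` in `[0,1]^d`. -/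
def IsDyadicCube {d : ℕ} (K : Set (Fin d → ℝ)) : Prop :=
  ∃ (n : ℕ) (k : Fin d → ℕ), (∀ i, k i < 2 ^ n) ∧
    K = Set.Icc (fun i => (k i : ℝ) / 2 ^ n) (fun i => ((k i : ℝ) + 1) / 2 ^ n)

/-- The `γ`-Hölder property: `|μ(K)| ≤ C |K|^γ` for all dyadic cubes `K`. -/
def IsHolderOnDyadic {d : ℕ} (γ : ℝ) (μ : BVSet d → ℝ) : Prop :=
  ∃ C : ℝ, 0 ≤ C ∧ ∀ K : BVSet d, IsDyadicCube K.carrier →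
    |μ K| ≤ C * (volume K.carrier).toReal ^ γ

/-! ### The fractional Brownian sheet -/

/-- The covariance of the fractional Brownian motion of Hurst index `h`. -/
def phi (h t t' : ℝ) : ℝ := (|t| ^ (2 * h) + |t'| ^ (2 * h) - |t - t'| ^ (2 * h)) / 2

/-- `W` is a fractional Brownian sheet on `[0,1]^d` of Hurst multiparameter `H`: a centered
Gaussian process with covariance `∏ φ^{H_i}(t_i, t_i')`. -/
structure IsFractionalBrownianSheet {d : ℕ} {Ω : Type*} [MeasurableSpace Ω] (H : Fin d → ℝ)
    (W : cube d → Ω → ℝ) (P : Measure Ω) : Prop where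
  gaussian : IsGaussianProcess W P
  centered : ∀ t, ∫ ω, W t ω ∂P = 0
  covariance : ∀ t t' : cube d,
    ∫ ω, W t ω * W t' ω ∂P = ∏ i, phi (H i) ((t : Fin d → ℝ) i) ((t' : Fin d → ℝ) i)

end FBS

end

noncomputable section

namespace FBS

/-! The charge is the limit of the densities `g_n` equal to `Δ_f(K) / |K|` on each dyadic cube `K`
of generation `n`. Each `g_n` is a bounded step function, so `u ↦ ∫ g_n u` belongs to `SCH d`, and
it suffices that these functionals form a Cauchy sequence in the dual of `BV`.

Additivity of `Δ_f` makes `(g_n)` a martingale: `g_{n+1} - g_n` has mean zero on each cube of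
generation `n`. Pairing it with `u` therefore involves only differences of integrals of `u` over
sibling cubes, which are translates of each other by vectors of length of order `2^{-n}`. Since `∫
|u(x + τ) - u(x)| ≤ |τ| ‖Du‖`, a bound `|g_n| ≤ C ρ^n` makes consecutive functionals differ by
`O((ρ/2)^n)` in norm, which is summable for `ρ < 2` (`abs_stepSum_succ_sub_le`,
`exists_tendsto_stepDual`). The limit takes the right values on dyadic rectangles, where the
sequence is eventually constant, and on all rectangles by continuity of `f` and of charges
(`apply_rect`).

For the sheet, the increment on a dyadic cube of side `2^{-n}` is a centered Gaussian variable of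
standard deviation `2^{-nS}`, with `S = ∑ H_i`. High moments and a sum over all dyadic cubes give
almost surely `|Δ_W(K)| ≤ C 2^{-ns}` for every `s < S`. Thus `ρ = 2^{d-s}`, and `ρ < 2` means `s > d
- 1`; such an `s` exists exactly when `S > d - 1`, i.e. when the mean Hurst index exceeds `(d-1)/d`.
The same bound with `s = dγ` is the Hölder property. -/

/-! ### The `L¹` translation estimate for functions of bounded variation -/

theorem abs_integral_mul_divergence_le {d : ℕ} {u : (Fin d → ℝ) → ℝ} (hu : variation u < ∞)
    {v : (Fin d → ℝ) → EuclideanSpace ℝ (Fin d)} (hv : ContDiff ℝ 1 v)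
    (hvc : HasCompactSupport v) {M : ℝ} (hM : 0 ≤ M) (hvM : ∀ x, ‖v x‖ ≤ M) :
    |∫ x, u x * divergence v x| ≤ M * (variation u).toReal := by
  rcases hM.eq_or_lt with rfl | hM
  · have : v = 0 := funext fun x => norm_le_zero_iff.1 (hvM x)
    simp [this, divergence]
  have hw : IsTestField (M⁻¹ • v) := by
    refine ⟨contDiff_const.smul hv, hvc.smul_left (f := fun _ => M⁻¹), fun x => ?_⟩
    rw [Pi.smul_apply, norm_smul, norm_inv, Real.norm_of_nonneg hM.le, inv_mul_le_iff₀ hM]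
    simpa using hvM x
  have key : ∀ w : (Fin d → ℝ) → EuclideanSpace ℝ (Fin d), IsTestField w →
      ∫ x, u x * divergence w x ≤ (variation u).toReal := fun w hw => by
    rw [← ENNReal.ofReal_le_iff_le_toReal hu.ne]
    exact le_iSup₂ (f := fun v (_ : IsTestField v) =>
      ENNReal.ofReal (∫ x, u x * divergence v x)) w hw
  have hdiv : ∀ x, divergence (M⁻¹ • v) x = M⁻¹ * divergence v x := fun x => by
    simp only [divergence, Finset.mul_sum]
    refine Finset.sum_congr rfl fun i _ => ?_
    rw [fderiv_const_smul (hv.differentiable (by norm_num) x)]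
    simp
  have h1 := key _ hw
  have h2 := key _ hw.neg
  simp only [divergence_neg, hdiv] at h1 h2
  have e : ∫ x, u x * (M⁻¹ * divergence v x) = M⁻¹ * ∫ x, u x * divergence v x := by
    rw [← integral_const_mul]; congr 1; ext x; ring
  simp only [mul_neg, integral_neg, e] at h1 h2
  rw [abs_le]
  rw [inv_mul_le_iff₀ hM] at h1
  rw [← mul_neg, inv_mul_le_iff₀ hM] at h2
  constructor <;> linarith

/-- Turns a directional derivative of a scalar test function into a divergence, so that the
variation of `u` controls `∫ u ∂_τ ψ`. -/
theorem divergence_smul_const {d : ℕ} {ψ : (Fin d → ℝ) → ℝ} (hψ : Differentiable ℝ ψ)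
    (τ : Fin d → ℝ) (x : Fin d → ℝ) :
    divergence (fun y => ψ y • WithLp.toLp 2 τ) x = fderiv ℝ ψ x τ := by
  have h : fderiv ℝ (fun y => ψ y • WithLp.toLp 2 τ) x
      = (fderiv ℝ ψ x).smulRight (WithLp.toLp 2 τ) := fderiv_smul_const (hψ x) _
  simp only [divergence, h, ContinuousLinearMap.smulRight_apply, PiLp.smul_apply, smul_eq_mul]
  conv_rhs => rw [pi_eq_sum_univ' τ, map_sum]
  refine Finset.sum_congr rfl fun i _ => ?_
  rw [map_smul, smul_eq_mul, mul_comm]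

theorem hasDerivAt_integral_mul_translate {d : ℕ} {u : (Fin d → ℝ) → ℝ} (hui : Integrable u)
    {ψ : (Fin d → ℝ) → ℝ} (hψ : ContDiff ℝ 1 ψ) (hψc : HasCompactSupport ψ) (τ : Fin d → ℝ)
    (t : ℝ) : HasDerivAt (fun t : ℝ => ∫ x, u x * ψ (x - t • τ))
      (∫ x, u x * (-(fderiv ℝ ψ (x - t • τ) τ))) t := by
  obtain ⟨C, hC⟩ := (hψc.fderiv (𝕜 := ℝ)).exists_bound_of_continuous
    (hψ.continuous_fderiv (by norm_num))
  obtain ⟨C₀, hC₀⟩ := hψc.exists_bound_of_continuous hψ.continuous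
  have hint : ∀ t : ℝ, Integrable (fun x => u x * ψ (x - t • τ)) := fun t =>
    hui.mul_bdd (hψ.continuous.comp (by fun_prop)).aestronglyMeasurable
      (ae_of_all _ fun x => hC₀ _)
  have hder : ∀ (t : ℝ) (x : Fin d → ℝ), HasDerivAt (fun t : ℝ => ψ (x - t • τ))
      (-(fderiv ℝ ψ (x - t • τ) τ)) t := fun t x => by
    have h1 : HasDerivAt (fun t : ℝ => x - t • τ) (-τ) t := by
      simpa using ((hasDerivAt_id t).smul_const τ).const_sub x
    rw [← map_neg]
    exact (hψ.differentiable (by norm_num) (x - t • τ)).hasFDerivAt.comp_hasDerivAt t h1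
  refine (hasDerivAt_integral_of_dominated_loc_of_deriv_le (Metric.ball_mem_nhds t one_pos)
    (F := fun t x => u x * ψ (x - t • τ)) (F' := fun t x => u x * (-(fderiv ℝ ψ (x - t • τ) τ)))
    (bound := fun x => |u x| * (C * ‖τ‖)) (.of_forall fun t => (hint t).aestronglyMeasurable)
    (hint t) ?_ ?_ (hui.abs.mul_const _) ?_).2
  · refine hui.aestronglyMeasurable.mul (Continuous.aestronglyMeasurable ?_)
    have := hψ.continuous_fderiv (by norm_num)
    exact ((this.comp (by fun_prop)).clm_apply continuous_const).neg
  · refine ae_of_all _ fun x s _ => ?_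
    rw [norm_mul, norm_neg, Real.norm_eq_abs]
    gcongr
    exact (ContinuousLinearMap.le_opNorm _ _).trans (by gcongr; exact hC _)
  · exact ae_of_all _ fun x s _ => (hder s x).const_mul (u x)

theorem abs_integral_mul_fderiv_le {d : ℕ} {u : (Fin d → ℝ) → ℝ}
    (hu : variation u < ∞) {ψ : (Fin d → ℝ) → ℝ} (hψ : ContDiff ℝ 1 ψ)
    (hψc : HasCompactSupport ψ) (hψ1 : ∀ x, |ψ x| ≤ 1) (τ : Fin d → ℝ) :
    |∫ x, u x * fderiv ℝ ψ x τ| ≤ ‖WithLp.toLp 2 τ‖ * (variation u).toReal := by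
  have h := abs_integral_mul_divergence_le hu (v := fun x => ψ x • WithLp.toLp 2 τ)
    (hψ.smul contDiff_const) hψc.smul_right
    (norm_nonneg (WithLp.toLp 2 τ)) fun x => by
      rw [norm_smul]
      exact mul_le_of_le_one_left (norm_nonneg _) (hψ1 _)
  simpa only [divergence_smul_const (hψ.differentiable (by norm_num))] using h

/-- Mean value inequality on `[0,1]` for `t ↦ ∫ u(x) ψ(x - tτ) dx`: its derivative is the pairing of
`u` with the divergence of a field of norm at most `|τ|`. The derivative falls on `ψ`, so `u` needs
no regularization. -/
theorem abs_integral_mul_translate_sub_le {d : ℕ} {u : (Fin d → ℝ) → ℝ} (hui : Integrable u)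
    (hu : variation u < ∞) {ψ : (Fin d → ℝ) → ℝ} (hψ : ContDiff ℝ 1 ψ)
    (hψc : HasCompactSupport ψ) (hψ1 : ∀ x, |ψ x| ≤ 1) (τ : Fin d → ℝ) :
    |∫ x, u x * (ψ (x - τ) - ψ x)| ≤ ‖WithLp.toLp 2 τ‖ * (variation u).toReal := by
  obtain ⟨C₀, hC₀⟩ := hψc.exists_bound_of_continuous hψ.continuous
  have hint : ∀ t : ℝ, Integrable (fun x => u x * ψ (x - t • τ)) := fun t =>
    hui.mul_bdd (hψ.continuous.comp (by fun_prop)).aestronglyMeasurable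
      (ae_of_all _ fun x => hC₀ _)
  have hbd : ∀ t : ℝ, ‖∫ x, u x * (-(fderiv ℝ ψ (x - t • τ) τ))‖
      ≤ ‖WithLp.toLp 2 τ‖ * (variation u).toReal := fun t => by
    have h := abs_integral_mul_fderiv_le hu (ψ := fun x => ψ (x - t • τ)) (hψ.comp (by fun_prop))
      (hψc.comp_homeomorph (Homeomorph.subRight (t • τ))) (fun x => hψ1 _) τ
    simp only [fderiv_comp_sub] at h
    simpa only [mul_neg, integral_neg, norm_neg, Real.norm_eq_abs] using h
  have := Convex.norm_image_sub_le_of_norm_hasDerivWithin_le (s := Set.univ)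
    (f := fun t : ℝ => ∫ x, u x * ψ (x - t • τ))
    (fun t _ => (hasDerivAt_integral_mul_translate hui hψ hψc τ t).hasDerivWithinAt)
    (fun t _ => hbd t) convex_univ (Set.mem_univ (0 : ℝ)) (Set.mem_univ (1 : ℝ))
  rw [← integral_sub (hint 1) (hint 0)] at this
  simpa [mul_sub] using this

/-- The `L¹` norm of an integrable function is controlled by duality with `C¹_c`. -/
theorem integral_abs_le_of_forall_contDiff {d : ℕ} {w : (Fin d → ℝ) → ℝ} (hw : Integrable w)
    {A : ℝ} (h : ∀ ψ : (Fin d → ℝ) → ℝ, ContDiff ℝ 1 ψ → HasCompactSupport ψ →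
      (∀ x, |ψ x| ≤ 1) → ∫ x, w x * ψ x ≤ A) : ∫ x, |w x| ≤ A := by
  suffices hR : ∀ n : ℕ, ∫ x in Metric.ball 0 (n : ℝ), |w x| ≤ A by
    have := (aecover_ball (μ := volume) (x := (0 : Fin d → ℝ))
      tendsto_natCast_atTop_atTop).integral_tendsto_of_countably_generated hw.abs
    exact le_of_tendsto' this hR
  -- The sign of `w` would be the optimal test function. It is cut off to a ball, to have compact
  -- support, and then mollified; mollification keeps the bound `1`. Where `w = 0` the convention `0
  -- / 0 = 0` gives the value `0`.
  intro R
  set s : (Fin d → ℝ) → ℝ := (Metric.ball 0 (R : ℝ)).indicator fun x => w x / |w x| with hs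
  have hs1 : ∀ x, ‖s x‖ ≤ 1 := fun x => by
    rw [hs]
    refine (norm_indicator_le_norm_self _ _).trans ?_
    rw [norm_div, Real.norm_eq_abs, Real.norm_eq_abs, abs_abs]
    exact div_self_le_one _
  have hsm : AEStronglyMeasurable s volume :=
    ((hw.aemeasurable.div hw.abs.aemeasurable).indicator
      Metric.isOpen_ball.measurableSet).aestronglyMeasurable
  have hsl : LocallyIntegrable s := by
    refine (locallyIntegrable_const (1 : ℝ)).mono hsm (ae_of_all _ fun x => ?_)
    simpa using hs1 x
  have hsc : HasCompactSupport s := HasCompactSupport.intro (isCompact_closedBall 0 (R : ℝ))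
    fun x hx => Set.indicator_of_notMem (fun h => hx (Metric.ball_subset_closedBall h)) _
  let φ : ℕ → ContDiffBump (0 : Fin d → ℝ) := fun n =>
    ⟨1 / ((n : ℝ) + 1), 2 * (1 / ((n : ℝ) + 1)), by positivity, by
      have : 0 < 1 / ((n : ℝ) + 1) := by positivity
      linarith⟩
  have hφ : Filter.Tendsto (fun n => (φ n).rOut) Filter.atTop (𝓝 0) := by
    have := (tendsto_one_div_add_atTop_nhds_zero_nat (𝕜 := ℝ)).const_mul 2
    rwa [mul_zero] at this
  have hae := ContDiffBump.ae_convolution_tendsto_right_of_locallyIntegrable (μ := volume)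
    (K := 2) hφ (.of_forall fun n => le_rfl) hsl
  set ψ : ℕ → (Fin d → ℝ) → ℝ := fun n =>
    MeasureTheory.convolution ((φ n).normed volume) s (ContinuousLinearMap.lsmul ℝ ℝ) volume with hψ
  have hψ1 : ∀ n x, ‖ψ n x‖ ≤ 1 := fun n x => by
    rw [hψ]
    refine (norm_integral_le_of_norm_le (g := fun t => (φ n).normed volume t)
      (φ n).integrable_normed (ae_of_all _ fun t => ?_)).trans (φ n).integral_normed.le
    simp only [ContinuousLinearMap.lsmul_apply, norm_smul]
    rw [Real.norm_of_nonneg ((φ n).nonneg_normed t)]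
    exact mul_le_of_le_one_right ((φ n).nonneg_normed t) (hs1 _)
  have hψd : ∀ n, ContDiff ℝ 1 (ψ n) := fun n =>
    (φ n).hasCompactSupport_normed.contDiff_convolution_left (n := 1) _ ((φ n).contDiff_normed) hsl
  have hψc : ∀ n, HasCompactSupport (ψ n) := fun n =>
    HasCompactSupport.convolution _ (φ n).hasCompactSupport_normed hsc
  have hlim : Filter.Tendsto (fun n => ∫ x, w x * ψ n x) Filter.atTop (𝓝 (∫ x, w x * s x)) := by
    refine tendsto_integral_of_dominated_convergence (fun x => |w x|)
      (fun n => hw.aestronglyMeasurable.mul (hψd n).continuous.aestronglyMeasurable) hw.abs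
      (fun n => ae_of_all _ fun x => ?_) ?_
    · rw [norm_mul, Real.norm_eq_abs]
      exact mul_le_of_le_one_right (abs_nonneg _) (hψ1 n x)
    · filter_upwards [hae] with x hx using hx.const_mul _
  have e : ∫ x, w x * s x = ∫ x in Metric.ball 0 (R : ℝ), |w x| := by
    rw [← integral_indicator Metric.isOpen_ball.measurableSet]
    congr 1; ext x
    by_cases hx : x ∈ Metric.ball (0 : Fin d → ℝ) R
    · rw [hs, Set.indicator_of_mem hx, Set.indicator_of_mem hx, ← mul_div_assoc, ← abs_mul_abs_self,
        mul_self_div_self]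
    · rw [hs, Set.indicator_of_notMem hx, Set.indicator_of_notMem hx, mul_zero]
  rw [← e]
  exact le_of_tendsto' hlim fun n => h _ (hψd n) (hψc n) (hψ1 n)

/-- Translates of a function of bounded variation. -/
theorem integral_abs_translate_sub_le {d : ℕ} {u : (Fin d → ℝ) → ℝ} (hui : Integrable u)
    (hu : variation u < ∞) (τ : Fin d → ℝ) :
    ∫ x, |u (x + τ) - u x| ≤ ‖WithLp.toLp 2 τ‖ * (variation u).toReal := by
  refine integral_abs_le_of_forall_contDiff ((hui.comp_add_right τ).sub hui) fun ψ hψ hψc hψ1 => ?_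
  refine le_trans (le_of_eq ?_) ((le_abs_self _).trans
    (abs_integral_mul_translate_sub_le hui hu hψ hψc hψ1 τ))
  have hb : ∀ᵐ x : Fin d → ℝ, ‖ψ x‖ ≤ 1 := ae_of_all _ hψ1
  have hb' : ∀ᵐ x : Fin d → ℝ, ‖ψ (x - τ)‖ ≤ 1 := ae_of_all _ fun x => hψ1 _
  have hm := hψ.continuous.aestronglyMeasurable (μ := (volume : Measure (Fin d → ℝ)))
  have hm' : AEStronglyMeasurable (fun x => ψ (x - τ)) (volume : Measure (Fin d → ℝ)) :=
    (hψ.continuous.comp (by fun_prop)).aestronglyMeasurable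
  simp only [Pi.sub_apply, sub_mul, mul_sub]
  rw [integral_sub ((hui.comp_add_right τ).mul_bdd hm hb) (hui.mul_bdd hm hb),
    integral_sub (hui.mul_bdd hm' hb') (hui.mul_bdd hm hb)]
  congr 1
  -- A change of variables moves the translation from `u` to the test function.
  rw [← integral_add_right_eq_self (fun x => u x * ψ (x - τ)) τ]
  simp

/-! ### Increments on grids -/

/-- The rectangular increment of a product function. -/
theorem sum_neg_one_pow_card_mul_prod {d : ℕ} {α : Type*} (G : Fin d → α → ℝ) (a b : Fin d → α) :
    ∑ s : Finset (Fin d), (-1) ^ s.card * ∏ i, G i (s.piecewise a b i)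
      = ∏ i, (G i (b i) - G i (a i)) := by
  rw [Finset.prod_sub, Finset.powerset_univ]
  refine Finset.sum_congr rfl fun s _ => ?_
  have : ∀ i, G i (s.piecewise a b i) = s.piecewise (fun i => G i (a i)) (fun i => G i (b i)) i :=
    fun i => by by_cases hi : i ∈ s <;> simp [hi]
  simp_rw [this]
  rw [Finset.prod_piecewise, Finset.univ_inter]
  ring

/-- Rectangular increments are additive along grids. -/
theorem sum_grid_increments {d : ℕ} (F : (Fin d → ℕ) → ℝ) {p q : Fin d → ℕ} (hpq : p ≤ q) :
    ∑ k ∈ Fintype.piFinset (fun i => Finset.Ico (p i) (q i)),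
        ∑ s : Finset (Fin d), (-1) ^ s.card * F (s.piecewise k (k + 1))
      = ∑ s : Finset (Fin d), (-1) ^ s.card * F (s.piecewise p q) := by
  set B := Fintype.piFinset (fun i => Finset.range (q i + 1)) with hB
  -- Writing `F` as a combination of point masses reduces the identity to product functions, for
  -- which the increment is a product and each coordinate telescopes. The finite box `B` contains
  -- every vertex that occurs.
  have hF : ∀ k ∈ B, F k = ∑ c ∈ B, F c * ∏ i, (if k i = c i then (1 : ℝ) else 0) := fun k hk => by
    simp only [Fintype.prod_ite_zero, Finset.prod_const_one, ← funext_iff]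
    simp [hk]
  have key : ∀ k l : Fin d → ℕ, k ≤ q → l ≤ q →
      ∑ s : Finset (Fin d), (-1) ^ s.card * F (s.piecewise k l) = ∑ c ∈ B, F c *
        ∏ i, ((if l i = c i then (1 : ℝ) else 0) - if k i = c i then (1 : ℝ) else 0) := by
    intro k l hk hl
    have h1 : ∀ s : Finset (Fin d), F (s.piecewise k l)
        = ∑ c ∈ B, F c * ∏ i, (if s.piecewise k l i = c i then (1 : ℝ) else 0) := fun s => by
      refine hF _ (Fintype.mem_piFinset.2 fun i => Finset.mem_range.2 (Nat.lt_succ_of_le ?_))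
      exact s.piecewise_le_of_le_of_le hk hl i
    simp_rw [h1, Finset.mul_sum]
    rw [Finset.sum_comm]
    refine Finset.sum_congr rfl fun c _ => ?_
    rw [← sum_neg_one_pow_card_mul_prod (fun i (n : ℕ) => if n = c i then (1 : ℝ) else 0) k l,
      Finset.mul_sum]
    exact Finset.sum_congr rfl fun s _ => by ring
  rw [key p q hpq le_rfl]
  have : ∀ k ∈ Fintype.piFinset (fun i => Finset.Ico (p i) (q i)),
      ∑ s : Finset (Fin d), (-1) ^ s.card * F (s.piecewise k (k + 1)) = ∑ c ∈ B, F c *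
        ∏ i, ((if k i + 1 = c i then (1 : ℝ) else 0) - if k i = c i then (1 : ℝ) else 0) := by
    intro k hk
    have hk' := fun i => Finset.mem_Ico.1 (Fintype.mem_piFinset.1 hk i)
    exact key k (k + 1) (fun i => (hk' i).2.le) (fun i => (hk' i).2)
  rw [Finset.sum_congr rfl this, Finset.sum_comm]
  refine Finset.sum_congr rfl fun c _ => ?_
  rw [← Finset.mul_sum]
  congr 1
  have h2 := Finset.prod_univ_sum (fun i => Finset.Ico (p i) (q i)) (fun i (n : ℕ) =>
    (if n + 1 = c i then (1 : ℝ) else 0) - if n = c i then (1 : ℝ) else 0)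
  rw [← h2]
  refine Finset.prod_congr rfl fun i _ => ?_
  exact Finset.sum_Ico_sub (fun n : ℕ => if n = c i then (1 : ℝ) else 0) (hpq i)

/-- The point of `[0,1]^d` with coordinates `k_i / 2^n` (truncated at `1`). -/
def gridPt {d : ℕ} (n : ℕ) (k : Fin d → ℕ) : cube d :=
  ⟨fun i => min ((k i : ℝ) / 2 ^ n) 1, fun i => by simp; positivity, fun i => by simp⟩

theorem gridPt_apply {d n : ℕ} {k : Fin d → ℕ} (hk : ∀ i, k i ≤ 2 ^ n) (i : Fin d) :
    (gridPt n k : Fin d → ℝ) i = (k i : ℝ) / 2 ^ n := by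
  refine min_eq_left ?_
  rw [div_le_one (by positivity)]
  exact_mod_cast hk i

theorem gridPt_add {d : ℕ} (n m : ℕ) (k : Fin d → ℕ) :
    gridPt (n + m) (fun i => 2 ^ m * k i) = gridPt n k := by
  refine Subtype.ext (funext fun i => ?_)
  simp only [gridPt]
  congr 1
  push_cast
  rw [pow_add, mul_comm (2 ^ n : ℝ), mul_div_mul_left _ _ (by positivity)]

theorem increment_gridPt {d : ℕ} (f : cube d → ℝ) (n : ℕ) (p q : Fin d → ℕ) :
    increment f (gridPt n p) (gridPt n q)
      = ∑ s : Finset (Fin d), (-1) ^ s.card * f (gridPt n (s.piecewise p q)) := by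
  refine Finset.sum_congr rfl fun s _ => ?_
  congr 2
  refine Subtype.ext (funext fun i => ?_)
  by_cases hi : i ∈ s <;> simp [vertex, gridPt, hi]

/-- The increment on the dyadic cube with index `k` of generation `n`. -/
def cellIncr {d : ℕ} (f : cube d → ℝ) (n : ℕ) (k : Fin d → ℕ) : ℝ :=
  increment f (gridPt n k) (gridPt n (k + 1))

theorem sum_cellIncr {d : ℕ} (f : cube d → ℝ) (n : ℕ) {p q : Fin d → ℕ} (hpq : p ≤ q) :
    ∑ k ∈ Fintype.piFinset (fun i => Finset.Ico (p i) (q i)), cellIncr f n k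
      = increment f (gridPt n p) (gridPt n q) := by
  simp only [cellIncr, increment_gridPt]
  exact sum_grid_increments (fun k => f (gridPt n k)) hpq

/-- The indices of the dyadic cubes of generation `n`. -/
def grid (d n : ℕ) : Finset (Fin d → ℕ) := Fintype.piFinset fun _ => Finset.range (2 ^ n)

theorem mem_grid {d n : ℕ} {k : Fin d → ℕ} : k ∈ grid d n ↔ ∀ i, k i < 2 ^ n := by
  simp [grid]

/-- The vertices of the discrete unit cube. -/
def corners (d : ℕ) : Finset (Fin d → ℕ) := Fintype.piFinset fun _ => Finset.range 2

theorem mem_corners {d : ℕ} {e : Fin d → ℕ} : e ∈ corners d ↔ ∀ i, e i < 2 := by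
  simp [corners]

theorem card_corners (d : ℕ) : (corners d).card = 2 ^ d := by
  simp [corners]

theorem sum_grid_succ {d n : ℕ} (g : (Fin d → ℕ) → ℝ) :
    ∑ k ∈ grid d (n + 1), g k = ∑ k ∈ grid d n, ∑ e ∈ corners d, g (2 • k + e) := by
  rw [← Finset.sum_product']
  symm
  refine Finset.sum_nbij' (fun x => 2 • x.1 + x.2) (fun k => (fun i => k i / 2, fun i => k i % 2))
    ?_ ?_ ?_ ?_ ?_
  · rintro ⟨k, e⟩ h
    simp only [Finset.mem_product, mem_grid, mem_corners] at h ⊢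
    intro i
    have h1 := h.1 i; have h2 := h.2 i
    simp only [Pi.add_apply, Pi.smul_apply, smul_eq_mul, pow_succ]
    omega
  · intro k h
    simp only [Finset.mem_product, mem_grid, mem_corners] at h ⊢
    refine ⟨fun i => ?_, fun i => Nat.mod_lt _ two_pos⟩
    have := h i
    rw [pow_succ] at this
    omega
  · rintro ⟨k, e⟩ h
    simp only [Finset.mem_product, mem_grid, mem_corners] at h
    refine Prod.ext (funext fun i => ?_) (funext fun i => ?_)
    · have h2 := h.2 i
      simp only [Pi.add_apply, Pi.smul_apply, smul_eq_mul]
      omega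
    · have h2 := h.2 i
      simp only [Pi.add_apply, Pi.smul_apply, smul_eq_mul]
      omega
  · intro k _
    funext i
    simp only [Pi.add_apply, Pi.smul_apply, smul_eq_mul]
    omega
  · intro x _; rfl

/-- The martingale property of the step densities: a cube of generation `n` is a `2 × ⋯ × 2` grid of
generation `n + 1`, and increments are additive along grids. -/
theorem sum_corners_cellIncr {d : ℕ} (f : cube d → ℝ) (n : ℕ) (k : Fin d → ℕ) :
    ∑ e ∈ corners d, cellIncr f (n + 1) (2 • k + e) = cellIncr f n k := by
  have h : cellIncr f n k = increment f (gridPt (n + 1) (2 • k)) (gridPt (n + 1) (2 • k + 2)) := by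
    rw [cellIncr, ← gridPt_add n 1 k, ← gridPt_add n 1 (k + 1)]
    congr 2
  rw [h, ← sum_cellIncr f (n + 1) (fun i => by simp)]
  refine Finset.sum_nbij' (fun e => 2 • k + e) (fun l => l - 2 • k) ?_ ?_ ?_ ?_ ?_
  · intro e he
    refine Fintype.mem_piFinset.2 fun i => Finset.mem_Ico.2 ?_
    have := mem_corners.1 he i
    simp only [Pi.add_apply, Pi.smul_apply, smul_eq_mul, Pi.ofNat_apply]
    omega
  · intro l hl
    refine mem_corners.2 fun i => ?_
    have := Finset.mem_Ico.1 (Fintype.mem_piFinset.1 hl i)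
    simp only [Pi.add_apply, Pi.sub_apply, Pi.smul_apply, smul_eq_mul, Pi.ofNat_apply] at this ⊢
    omega
  · intro e _; simp
  · intro l hl
    funext i
    have := Finset.mem_Ico.1 (Fintype.mem_piFinset.1 hl i)
    simp only [Pi.add_apply, Pi.sub_apply, Pi.smul_apply, smul_eq_mul] at this ⊢
    omega
  · intro e _; rfl

/-! ### Dyadic cells -/

/-- The half-open dyadic cube with index `k` of generation `n`. -/
def cell {d : ℕ} (n : ℕ) (k : Fin d → ℕ) : Set (Fin d → ℝ) :=
  Set.pi Set.univ fun i => Set.Ico ((k i : ℝ) / 2 ^ n) (((k i : ℝ) + 1) / 2 ^ n)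

/-- Reduces disjointness, subdivision and translation of cells to integer arithmetic. -/
theorem mem_cell {d n : ℕ} {k : Fin d → ℕ} {x : Fin d → ℝ} :
    x ∈ cell n k ↔ ∀ i, ⌊2 ^ n * x i⌋ = (k i : ℤ) := by
  have hp : (0 : ℝ) < 2 ^ n := by positivity
  simp only [cell, Set.mem_univ_pi, Set.mem_Ico, Int.floor_eq_iff]
  refine forall_congr' fun i => ?_
  rw [div_le_iff₀ hp, lt_div_iff₀ hp, mul_comm]
  norm_cast

theorem measurableSet_cell {d : ℕ} (n : ℕ) (k : Fin d → ℕ) : MeasurableSet (cell n k) :=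
  MeasurableSet.univ_pi fun _ => measurableSet_Ico

theorem disjoint_cell {d n : ℕ} {k l : Fin d → ℕ} (h : k ≠ l) :
    Disjoint (cell n k) (cell n l) := by
  refine Set.disjoint_left.2 fun x hk hl => h (funext fun i => ?_)
  have := (mem_cell.1 hk i).symm.trans (mem_cell.1 hl i)
  exact_mod_cast this

theorem volume_cell {d : ℕ} (n : ℕ) (k : Fin d → ℕ) :
    volume.real (cell n k) = (2 ^ (n * d) : ℝ)⁻¹ := by
  have : ∀ i, (k i : ℝ) / 2 ^ n ≤ ((k i : ℝ) + 1) / 2 ^ n := fun i => by gcongr; linarith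
  rw [Measure.real, cell, Real.volume_pi_Ico_toReal this]
  simp [← sub_div, pow_mul]

theorem cell_subset_cube {d n : ℕ} {k : Fin d → ℕ} (hk : k ∈ grid d n) : cell n k ⊆ cube d := by
  intro x hx
  have hx' := fun i => Set.mem_univ_pi.1 hx i
  refine ⟨fun i => le_trans (by simp; positivity) (hx' i).1, fun i => (hx' i).2.le.trans ?_⟩
  rw [Pi.one_apply, div_le_one (by positivity)]
  exact_mod_cast mem_grid.1 hk i

theorem cell_eq_iUnion_corners {d : ℕ} (n : ℕ) (k : Fin d → ℕ) :
    cell n k = ⋃ e ∈ corners d, cell (n + 1) (2 • k + e) := by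
  have hfl : ∀ y : ℝ, ⌊y⌋ = ⌊2 * y⌋ / 2 := fun y => by
    have := Int.floor_div_natCast (2 * y) 2
    simpa using this
  ext x
  simp only [Set.mem_iUnion, exists_prop, mem_cell, mem_corners]
  have hx : ∀ i, ⌊2 ^ n * x i⌋ = ⌊2 ^ (n + 1) * x i⌋ / 2 := fun i => by
    rw [hfl, pow_succ, mul_comm (2 ^ n) (2 : ℝ), mul_assoc]
  constructor
  · intro h
    refine ⟨fun i => (⌊2 ^ (n + 1) * x i⌋ % 2).toNat, fun i => ?_, fun i => ?_⟩
    · dsimp only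
      omega
    have h1 := h i
    rw [hx] at h1
    simp only [Pi.add_apply, Pi.smul_apply, smul_eq_mul]
    push_cast
    omega
  · rintro ⟨e, he, h⟩ i
    have h1 := h i
    have h2 := he i
    rw [hx]
    simp only [Pi.add_apply, Pi.smul_apply, smul_eq_mul] at h1
    push_cast at h1
    omega

theorem setIntegral_cell {d n : ℕ} (k : Fin d → ℕ) {u : (Fin d → ℝ) → ℝ} (hu : Integrable u) :
    ∫ x in cell n k, u x = ∑ e ∈ corners d, ∫ x in cell (n + 1) (2 • k + e), u x := by
  rw [cell_eq_iUnion_corners]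
  refine integral_biUnion_finset _ (fun e _ => measurableSet_cell _ _) ?_
    (fun e _ => hu.integrableOn)
  exact fun e _ e' _ h => disjoint_cell (by simpa using h)

theorem setIntegral_cell_add {d n : ℕ} (k e : Fin d → ℕ) (u : (Fin d → ℝ) → ℝ) :
    ∫ x in cell n (k + e), u x
      = ∫ x in cell n k, u (x + fun i => (2 ^ n : ℝ)⁻¹ * e i) := by
  rw [← integral_indicator (measurableSet_cell _ _), ← integral_indicator (measurableSet_cell _ _),
    ← integral_add_right_eq_self _ (fun i => (2 ^ n : ℝ)⁻¹ * e i)]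
  congr 1
  ext x
  have : x + (fun i => (2 ^ n : ℝ)⁻¹ * e i) ∈ cell n (k + e) ↔ x ∈ cell n k := by
    simp only [mem_cell, Pi.add_apply]
    refine forall_congr' fun i => ?_
    rw [mul_add, mul_inv_cancel_left₀ (by positivity), Int.floor_add_natCast]
    push_cast
    omega
  by_cases hx : x ∈ cell n k
  · rw [Set.indicator_of_mem hx, Set.indicator_of_mem (this.2 hx)]
  · rw [Set.indicator_of_notMem hx, Set.indicator_of_notMem (fun h => hx (this.1 h))]

/-! ### Step functions approximating an increment function -/

/-- The integral of `u` against the step function equal to `Δ_f(K) / |K|` on each dyadic cube `K`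
of generation `n`. -/
def stepSum {d : ℕ} (f : cube d → ℝ) (n : ℕ) (u : (Fin d → ℝ) → ℝ) : ℝ :=
  ∑ k ∈ grid d n, 2 ^ (n * d) * cellIncr f n k * ∫ x in cell n k, u x

/-- The coefficients sum to zero over the children of each cube, so the integral of `u` over the
reference child `e = 0` may be subtracted freely. Only differences of `u` between translated cells
remain. -/
theorem stepSum_succ_sub {d : ℕ} (f : cube d → ℝ) (n : ℕ) {u : (Fin d → ℝ) → ℝ}
    (hu : Integrable u) :
    stepSum f (n + 1) u - stepSum f n u = ∑ e ∈ corners d, ∑ k ∈ grid d n,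
      (2 ^ ((n + 1) * d) * cellIncr f (n + 1) (2 • k + e) - 2 ^ (n * d) * cellIncr f n k) *
        ((∫ x in cell (n + 1) (2 • k + e), u x) - ∫ x in cell (n + 1) (2 • k), u x) := by
  rw [stepSum, stepSum, sum_grid_succ, ← Finset.sum_sub_distrib, Finset.sum_comm (s := corners d)]
  refine Finset.sum_congr rfl fun k _ => ?_
  have h0 : ∑ e ∈ corners d,
      (2 ^ ((n + 1) * d) * cellIncr f (n + 1) (2 • k + e) - 2 ^ (n * d) * cellIncr f n k) = 0 := by
    rw [Finset.sum_sub_distrib, ← Finset.mul_sum, sum_corners_cellIncr, Finset.sum_const,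
      card_corners, nsmul_eq_mul]
    push_cast
    ring
  simp_rw [mul_sub _ (∫ x in cell (n + 1) (2 • k + _), u x)]
  rw [Finset.sum_sub_distrib, ← Finset.sum_mul, h0, zero_mul, sub_zero, setIntegral_cell k hu,
    Finset.mul_sum, ← Finset.sum_sub_distrib]
  exact Finset.sum_congr rfl fun e _ => by ring

/-- The key estimate. Densities of size `ρ^n` meet translations of size `2^{-n-1}`. For a fixed
corner `e` all cells are shifted by the same vector, so the sum over cells is at most one global
translation integral. -/
theorem abs_stepSum_succ_sub_le {d : ℕ} {f : cube d → ℝ} {C ρ : ℝ} (hC : 0 ≤ C) (hρ : 0 ≤ ρ)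
    (hf : ∀ n, ∀ k ∈ grid d n, 2 ^ (n * d) * |cellIncr f n k| ≤ C * ρ ^ n)
    (n : ℕ) {u : (Fin d → ℝ) → ℝ} (hui : Integrable u) (hu : variation u < ∞) :
    |stepSum f (n + 1) u - stepSum f n u| ≤
      (C * (1 + ρ) * ∑ e ∈ corners d, ‖WithLp.toLp 2 (fun i => (e i : ℝ))‖) * (ρ / 2) ^ n
        * (variation u).toReal := by
  set M := C * (1 + ρ) * ρ ^ n with hM
  have hM0 : 0 ≤ M := by positivity
  -- The densities of generations `n + 1` and `n` are bounded by `C ρ^{n+1}` and `C ρ^n`, whence the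
  -- factor `1 + ρ`.
  have hc : ∀ e ∈ corners d, ∀ k ∈ grid d n,
      |2 ^ ((n + 1) * d) * cellIncr f (n + 1) (2 • k + e) - 2 ^ (n * d) * cellIncr f n k| ≤ M := by
    intro e he k hk
    have hk' : 2 • k + e ∈ grid d (n + 1) := mem_grid.2 fun i => by
      have h1 := mem_grid.1 hk i
      have h2 := mem_corners.1 he i
      simp only [Pi.add_apply, Pi.smul_apply, smul_eq_mul, pow_succ]
      omega
    refine (abs_sub _ _).trans ?_
    rw [abs_mul, abs_mul, abs_of_pos (by positivity : (0 : ℝ) < 2 ^ ((n + 1) * d)),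
      abs_of_pos (by positivity : (0 : ℝ) < 2 ^ (n * d))]
    refine (add_le_add (hf _ _ hk') (hf _ _ hk)).trans (le_of_eq ?_)
    rw [hM]; ring
  have htr : ∀ e : Fin d → ℕ, ∑ k ∈ grid d n,
      |(∫ x in cell (n + 1) (2 • k + e), u x) - ∫ x in cell (n + 1) (2 • k), u x|
        ≤ (2 ^ (n + 1) : ℝ)⁻¹ * ‖WithLp.toLp 2 (fun i => (e i : ℝ))‖ * (variation u).toReal := by
    intro e
    set τ : Fin d → ℝ := fun i => (2 ^ (n + 1) : ℝ)⁻¹ * e i with hτ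
    have hw : Integrable fun x => |u (x + τ) - u x| := ((hui.comp_add_right τ).sub hui).abs
    have h1 : ‖WithLp.toLp 2 τ‖ = (2 ^ (n + 1) : ℝ)⁻¹ * ‖WithLp.toLp 2 (fun i => (e i : ℝ))‖ := by
      have : WithLp.toLp 2 τ = (2 ^ (n + 1) : ℝ)⁻¹ • WithLp.toLp 2 (fun i => (e i : ℝ)) := rfl
      rw [this, norm_smul, Real.norm_of_nonneg (by positivity)]
    rw [← h1]
    refine le_trans ?_ (integral_abs_translate_sub_le hui hu τ)
    calc _ ≤ ∑ k ∈ grid d n, ∫ x in cell (n + 1) (2 • k), |u (x + τ) - u x| := by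
          refine Finset.sum_le_sum fun k _ => ?_
          rw [setIntegral_cell_add, ← integral_sub (hui.comp_add_right τ).integrableOn
            hui.integrableOn]
          exact abs_integral_le_integral_abs
      _ = ∫ x in ⋃ k ∈ grid d n, cell (n + 1) (2 • k), |u (x + τ) - u x| := by
          refine (integral_biUnion_finset _ (fun k _ => measurableSet_cell _ _) ?_
            (fun k _ => hw.integrableOn)).symm
          intro k _ l _ h
          refine disjoint_cell fun h' => h (funext fun i => ?_)
          have := congrFun h' i
          simp only [Pi.smul_apply, smul_eq_mul] at this
          omega
      _ ≤ _ := setIntegral_le_integral hw (ae_of_all _ fun x => abs_nonneg _)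
  rw [stepSum_succ_sub f n hui]
  calc _ ≤ ∑ e ∈ corners d, ∑ k ∈ grid d n, M *
        |(∫ x in cell (n + 1) (2 • k + e), u x) - ∫ x in cell (n + 1) (2 • k), u x| := by
        refine (Finset.abs_sum_le_sum_abs _ _).trans (Finset.sum_le_sum fun e he => ?_)
        refine (Finset.abs_sum_le_sum_abs _ _).trans (Finset.sum_le_sum fun k hk => ?_)
        rw [abs_mul]
        exact mul_le_mul_of_nonneg_right (hc e he k hk) (abs_nonneg _)
    _ ≤ ∑ e ∈ corners d, M * ((2 ^ (n + 1) : ℝ)⁻¹ * ‖WithLp.toLp 2 (fun i => (e i : ℝ))‖ *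
          (variation u).toReal) := by
        refine Finset.sum_le_sum fun e _ => ?_
        rw [← Finset.mul_sum]
        exact mul_le_mul_of_nonneg_left (htr e) hM0
    _ = (M * (2 ^ (n + 1) : ℝ)⁻¹) * (∑ e ∈ corners d, ‖WithLp.toLp 2 (fun i => (e i : ℝ))‖) *
          (variation u).toReal := by
        rw [Finset.mul_sum, Finset.sum_mul]
        exact Finset.sum_congr rfl fun e _ => by ring
    _ ≤ _ := by
        have hS : 0 ≤ ∑ e ∈ corners d, ‖WithLp.toLp 2 (fun i => (e i : ℝ))‖ :=
          Finset.sum_nonneg fun _ _ => norm_nonneg _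
        -- A factor `1/2` is given up here for a cleaner constant.
        have h2 : M * (2 ^ (n + 1) : ℝ)⁻¹ ≤ C * (1 + ρ) * (ρ / 2) ^ n := by
          rw [hM, div_pow, div_eq_mul_inv, ← mul_assoc]
          gcongr
          · norm_num
          · omega
        have := mul_le_mul_of_nonneg_right h2 hS
        refine (mul_le_mul_of_nonneg_right this ENNReal.toReal_nonneg).trans (le_of_eq ?_)
        ring

/-! ### The associated functionals on `BV([0,1]^d)` -/

theorem BVCube.integrable {d : ℕ} (u : BVCube d) : Integrable u := L1.integrable_coeFn _

/-- The step function equal to `Δ_f(K) / |K|` on each dyadic cube `K` of generation `n`. -/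
def stepFun {d : ℕ} (f : cube d → ℝ) (n : ℕ) (x : Fin d → ℝ) : ℝ :=
  ∑ k ∈ grid d n, (cell n k).indicator (fun _ => 2 ^ (n * d) * cellIncr f n k) x

theorem measurable_stepFun {d : ℕ} (f : cube d → ℝ) (n : ℕ) : Measurable (stepFun f n) :=
  Finset.measurable_fun_sum _ fun k _ => measurable_const.indicator (measurableSet_cell n k)

theorem abs_stepFun_le {d : ℕ} (f : cube d → ℝ) (n : ℕ) (x : Fin d → ℝ) :
    |stepFun f n x| ≤ ∑ k ∈ grid d n, |2 ^ (n * d) * cellIncr f n k| :=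
  (Finset.abs_sum_le_sum_abs _ _).trans
    (Finset.sum_le_sum fun k _ =>
      norm_indicator_le_norm_self (fun _ => (2 : ℝ) ^ (n * d) * cellIncr f n k) x)

theorem memLp_stepFun {d : ℕ} (f : cube d → ℝ) (n : ℕ) (p : ℝ≥0∞) :
    MemLp (stepFun f n) p (volume.restrict (cube d)) := by
  have : IsFiniteMeasure (volume.restrict (cube d)) :=
    ⟨by simpa using (isCompact_Icc (a := (0 : Fin d → ℝ)) (b := 1)).measure_lt_top⟩
  exact MemLp.of_bound (measurable_stepFun f n).aestronglyMeasurable _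
    (ae_of_all _ (abs_stepFun_le f n))

theorem stepSum_eq_setIntegral {d : ℕ} (f : cube d → ℝ) (n : ℕ) {u : (Fin d → ℝ) → ℝ}
    (hu : Integrable u) : stepSum f n u = ∫ x in cube d, stepFun f n x * u x := by
  simp only [stepFun, Finset.sum_mul]
  rw [integral_finsetSum]
  · refine Finset.sum_congr rfl fun k hk => ?_
    have : ∀ x, (cell n k).indicator (fun _ => 2 ^ (n * d) * cellIncr f n k) x * u x
        = (cell n k).indicator (fun x => 2 ^ (n * d) * cellIncr f n k * u x) x := fun x => by
      by_cases hx : x ∈ cell n k <;> simp [hx]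
    simp_rw [this]
    rw [integral_indicator (measurableSet_cell n k), Measure.restrict_restrict (measurableSet_cell n k),
      Set.inter_eq_left.2 (cell_subset_cube hk), integral_const_mul]
  · intro k _
    refine hu.integrableOn.bdd_mul (c := ‖(2 : ℝ) ^ (n * d) * cellIncr f n k‖)
      (measurable_const.indicator (measurableSet_cell n k)).aestronglyMeasurable
      (ae_of_all _ fun x => norm_indicator_le_norm_self (fun _ => _) x)

theorem abs_stepSum_le {d : ℕ} (f : cube d → ℝ) (n : ℕ) {u : (Fin d → ℝ) → ℝ}
    (hu : Integrable u) :
    |stepSum f n u| ≤ (∑ k ∈ grid d n, |2 ^ (n * d) * cellIncr f n k|) * ∫ x, |u x| := by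
  rw [stepSum, Finset.sum_mul]
  refine (Finset.abs_sum_le_sum_abs _ _).trans (Finset.sum_le_sum fun k _ => ?_)
  rw [abs_mul]
  refine mul_le_mul_of_nonneg_left (abs_integral_le_integral_abs.trans ?_) (abs_nonneg _)
  exact setIntegral_le_integral hu.abs (ae_of_all _ fun x => abs_nonneg _)

theorem stepSum_congr {d : ℕ} (f : cube d → ℝ) (n : ℕ) {u w : (Fin d → ℝ) → ℝ}
    (h : u =ᵐ[volume] w) : stepSum f n u = stepSum f n w :=
  Finset.sum_congr rfl fun _ _ => by rw [integral_congr_ae (ae_restrict_of_ae h)]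

theorem integral_abs_le_norm {d : ℕ} (u : BVCube d) : ∫ x, |u x| ≤ ‖u‖ := by
  rw [BVCube.norm_def]
  exact le_add_of_nonneg_right ENNReal.toReal_nonneg

theorem variation_toReal_le_norm {d : ℕ} (u : BVCube d) : (variation u).toReal ≤ ‖u‖ := by
  rw [BVCube.norm_def]
  exact le_add_of_nonneg_left (integral_nonneg fun x => abs_nonneg _)

/-- `stepSum f n` as a continuous functional on `BV([0,1]^d)`. -/
def stepDual {d : ℕ} (f : cube d → ℝ) (n : ℕ) : StrongDual ℝ (BVCube d) :=
  LinearMap.mkContinuous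
    { toFun := fun u => stepSum f n u
      map_add' := fun u w => by
        rw [map_add, stepSum_congr f n (Lp.coeFn_add _ _)]
        simp only [stepSum, Pi.add_apply]
        rw [← Finset.sum_add_distrib]
        refine Finset.sum_congr rfl fun k _ => ?_
        rw [integral_add u.integrable.integrableOn w.integrable.integrableOn, mul_add]
      map_smul' := fun c u => by
        rw [map_smul, stepSum_congr f n (Lp.coeFn_smul _ _)]
        simp only [stepSum, Pi.smul_apply, smul_eq_mul, RingHom.id_apply, integral_const_mul,
          Finset.mul_sum]
        exact Finset.sum_congr rfl fun k _ => by ring }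
    (∑ k ∈ grid d n, |2 ^ (n * d) * cellIncr f n k|)
    fun u => (abs_stepSum_le f n u.integrable).trans (mul_le_mul_of_nonneg_left
      (integral_abs_le_norm u) (Finset.sum_nonneg fun _ _ => abs_nonneg _))

theorem stepDual_apply {d : ℕ} (f : cube d → ℝ) (n : ℕ) (u : BVCube d) :
    stepDual f n u = stepSum f n u := rfl

theorem stepDual_mem_SCH {d : ℕ} (f : cube d → ℝ) (n : ℕ) : stepDual f n ∈ SCH d :=
  subset_closure ⟨stepFun f n, memLp_stepFun f n d, fun u =>
    stepSum_eq_setIntegral f n u.integrable⟩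

/-- Consecutive functionals differ by a geometric sequence of ratio `ρ / 2 < 1` in operator norm,
the dual is complete, and `SCH d` is closed by definition. -/
theorem exists_tendsto_stepDual {d : ℕ} {f : cube d → ℝ} {C ρ : ℝ} (hC : 0 ≤ C) (hρ : 0 ≤ ρ)
    (hρ2 : ρ < 2) (hf : ∀ n, ∀ k ∈ grid d n, 2 ^ (n * d) * |cellIncr f n k| ≤ C * ρ ^ n) :
    ∃ α ∈ SCH d, Filter.Tendsto (stepDual f) Filter.atTop (𝓝 α) := by
  have hcau : CauchySeq (stepDual f) := by
    refine cauchySeq_of_le_geometric (ρ / 2)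
      (C * (1 + ρ) * ∑ e ∈ corners d, ‖WithLp.toLp 2 (fun i => (e i : ℝ))‖) (by linarith)
      fun n => ?_
    have hS : 0 ≤ ∑ e ∈ corners d, ‖WithLp.toLp 2 (fun i => (e i : ℝ))‖ :=
      Finset.sum_nonneg fun _ _ => norm_nonneg _
    rw [dist_comm, dist_eq_norm]
    refine ContinuousLinearMap.opNorm_le_bound _ (by positivity) fun u => ?_
    refine (abs_stepSum_succ_sub_le hC hρ hf n u.integrable u.variation_lt_top).trans ?_
    exact mul_le_mul_of_nonneg_left (variation_toReal_le_norm u) (by positivity)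
  obtain ⟨α, hα⟩ := cauchySeq_tendsto_of_complete hcau
  exact ⟨α, isClosed_closure.mem_of_tendsto hα (.of_forall fun n => stepDual_mem_SCH f n), hα⟩

/-! ### Charges defined by limits of step functionals -/

theorem BVSet.ind_ae_eq {d : ℕ} (B : BVSet d) :
    (B.ind : (Fin d → ℝ) → ℝ) =ᵐ[volume] B.carrier.indicator fun _ => 1 :=
  B.integrable_indicator.coeFn_toL1

theorem BVCube.ext_ae {d : ℕ} {u w : BVCube d}
    (h : (u : (Fin d → ℝ) → ℝ) =ᵐ[volume] (w : (Fin d → ℝ) → ℝ)) : u = w :=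
  Subtype.ext (Lp.ext h)

/-- The indicator function of an almost disjoint union. -/
theorem BVSet.ind_eq_sum {d m : ℕ} (R : Fin m → BVSet d) (F : BVSet d)
    (hF : F.carrier = ⋃ j, (R j).carrier)
    (hdisj : ∀ j k, j ≠ k → volume ((R j).carrier ∩ (R k).carrier) = 0) :
    F.ind = ∑ j, (R j).ind := by
  refine BVCube.ext_ae ?_
  rw [map_sum]
  have h1 : ∀ᵐ x, ∀ j k, j ≠ k → x ∉ (R j).carrier ∩ (R k).carrier := by
    simp only [ae_all_iff]
    exact fun j k h => measure_eq_zero_iff_ae_notMem.1 (hdisj j k h)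
  have h2 : ∀ᵐ x, ∀ j, (R j).ind x = (R j).carrier.indicator (fun _ => 1) x :=
    ae_all_iff.2 fun j => (R j).ind_ae_eq
  filter_upwards [h1, h2, F.ind_ae_eq,
    Lp.coeFn_finsetSum Finset.univ fun j => BVCube.toL1 (R j).ind] with x hx h2x hFx hs
  rw [hFx, hs, Finset.sum_apply, Finset.sum_congr rfl fun j _ => h2x j]
  by_cases hU : x ∈ F.carrier
  · rw [Set.indicator_of_mem hU]
    rw [hF] at hU
    obtain ⟨j, hj⟩ := Set.mem_iUnion.1 hU
    rw [Finset.sum_eq_single j, Set.indicator_of_mem hj]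
    · exact fun k _ hk => Set.indicator_of_notMem (fun h => hx k j hk ⟨h, hj⟩) _
    · simp
  · rw [Set.indicator_of_notMem hU, Finset.sum_eq_zero]
    rw [hF] at hU
    exact fun j _ => Set.indicator_of_notMem (fun h => hU (Set.mem_iUnion.2 ⟨j, h⟩)) _

theorem BVSet.norm_ind_le {d : ℕ} (B : BVSet d) :
    ‖B.ind‖ ≤ 1 + (perimeter B.carrier).toReal := by
  rw [BVCube.norm_def, variation_congr B.ind_ae_eq]
  refine add_le_add_left ?_ _
  rw [integral_congr_ae (B.ind_ae_eq.mono fun x hx => congrArg abs hx)]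
  have e : (fun x => |B.carrier.indicator (fun _ => (1 : ℝ)) x|)
      = B.carrier.indicator fun _ => (1 : ℝ) := by
    ext x
    by_cases hx : x ∈ B.carrier <;> simp [hx]
  rw [e, integral_indicator₀ B.nullMeasurable, setIntegral_const, smul_eq_mul, mul_one]
  refine ENNReal.toReal_le_of_le_ofReal zero_le_one ((measure_mono B.subset_cube).trans ?_)
  rw [Real.volume_Icc_pi]
  simp

theorem BVSet.integral_abs_ind_sub {d : ℕ} (A B : BVSet d) :
    ∫ x, |(A.ind - B.ind : BVCube d) x| = (volume (symmDiff A.carrier B.carrier)).toReal := by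
  have h : (fun x => |(A.ind - B.ind : BVCube d) x|)
      =ᵐ[volume] (symmDiff A.carrier B.carrier).indicator fun _ => (1 : ℝ) := by
    rw [map_sub]
    filter_upwards [A.ind_ae_eq, B.ind_ae_eq,
      Lp.coeFn_sub (BVCube.toL1 A.ind) (BVCube.toL1 B.ind)] with x hA hB hs
    rw [hs, Pi.sub_apply, hA, hB]
    by_cases h1 : x ∈ A.carrier <;> by_cases h2 : x ∈ B.carrier <;>
      simp [h1, h2, Set.mem_symmDiff]
  rw [integral_congr_ae h, integral_indicator₀ (A.nullMeasurable.symmDiff B.nullMeasurable),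
    setIntegral_const, smul_eq_mul, mul_one, Measure.real]

/-- Each step functional is continuous for the `L¹` norm. On sets of bounded perimeter the
indicators are bounded in `BV`, so convergence in operator norm is uniform there and the `L¹`
continuity passes to the limit. -/
theorem isCharge_of_tendsto_stepDual {d : ℕ} {f : cube d → ℝ} {α : StrongDual ℝ (BVCube d)}
    (hα : Filter.Tendsto (stepDual f) Filter.atTop (𝓝 α)) :
    IsCharge fun B : BVSet d => α B.ind where
  additive B₁ B₂ B h0 hB := by
    have := BVSet.ind_eq_sum ![B₁, B₂] B (by
      rw [hB]; ext x; simp [Fin.exists_fin_two]) (by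
      intro j k hjk
      fin_cases j <;> fin_cases k <;> simp_all [Set.inter_comm])
    rw [this, Fin.sum_univ_two, map_add]
    rfl
  tendsto B B' hper hvol := by
    set p := (⨆ n, perimeter (B n).carrier).toReal with hp
    set A := (1 + p) + (1 + (perimeter B'.carrier).toReal) with hA
    have hp0 : 0 ≤ p := ENNReal.toReal_nonneg
    have hA0 : 0 < A := by positivity
    have hn : ∀ n, ‖(B n).ind - B'.ind‖ ≤ A := fun n => by
      refine (norm_sub_le _ _).trans (add_le_add ((B n).norm_ind_le.trans ?_) B'.norm_ind_le)
      gcongr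
      exact ENNReal.toReal_mono hper.ne (le_iSup (fun n => perimeter (B n).carrier) n)
    rw [Metric.tendsto_atTop]
    intro ε hε
    obtain ⟨m, hm⟩ := (Metric.tendsto_atTop.1 hα (ε / (2 * A)) (by positivity))
    have hm := hm m le_rfl
    rw [dist_comm, dist_eq_norm] at hm
    set C := ∑ k ∈ grid d m, |2 ^ (m * d) * cellIncr f m k| with hC
    have hC0 : 0 ≤ C := Finset.sum_nonneg fun _ _ => abs_nonneg _
    have hvol' := (ENNReal.continuousAt_toReal ENNReal.zero_ne_top).tendsto.comp hvol
    -- `C` is an `L¹` bound of the step functional and may vanish, hence `C + 1` in the denominator.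
    obtain ⟨N, hN⟩ := Metric.tendsto_atTop.1 hvol' (ε / (2 * (C + 1))) (by positivity)
    refine ⟨N, fun n hnN => ?_⟩
    have h1 := hN n hnN
    rw [Function.comp_apply, ENNReal.toReal_zero, Real.dist_0_eq_abs,
      abs_of_nonneg ENNReal.toReal_nonneg] at h1
    rw [Real.dist_eq, ← map_sub]
    have h2 : α ((B n).ind - B'.ind)
        = (α - stepDual f m) ((B n).ind - B'.ind) + stepDual f m ((B n).ind - B'.ind) := by simp
    have h3 : |(α - stepDual f m) ((B n).ind - B'.ind)| ≤ ε / (2 * A) * A :=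
      (ContinuousLinearMap.le_opNorm _ _).trans (mul_le_mul hm.le (hn n) (norm_nonneg _)
        (by positivity))
    have h4 : |stepDual f m ((B n).ind - B'.ind)| < ε / 2 := by
      rw [stepDual_apply]
      refine (abs_stepSum_le f m (BVCube.integrable _)).trans_lt ?_
      rw [BVSet.integral_abs_ind_sub, ← hC]
      calc C * _ ≤ (C + 1) * (volume (symmDiff (B n).carrier B'.carrier)).toReal := by
            gcongr; linarith
        _ < (C + 1) * (ε / (2 * (C + 1))) := by gcongr
        _ = ε / 2 := by field_simp
    have h5 : ε / (2 * A) * A = ε / 2 := by field_simp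
    rw [h2]
    refine (abs_add_le _ _).trans_lt ?_
    linarith

/-! ### Evaluation on rectangles -/

/-- By the divergence theorem the integral is a flux through `2d` faces, each of volume at most `1`.
A bound independent of the rectangle is what continuity of charges along a sequence of rectangles
requires. -/
theorem perimeter_Icc_le {d : ℕ} {a b : Fin d → ℝ} (ha : a ∈ cube d) (hb : b ∈ cube d)
    (hab : a ≤ b) : perimeter (Set.Icc a b) ≤ ENNReal.ofReal (2 * d) := by
  cases d with
  | zero => simp [perimeter, variation, divergence]
  | succ n =>
    refine iSup₂_le fun v hv => ENNReal.ofReal_le_ofReal ?_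
    have h1 : ∫ x, (Set.Icc a b).indicator (fun _ => (1 : ℝ)) x * divergence v x
        = ∫ x in Set.Icc a b, ∑ i,
          ((EuclideanSpace.proj (𝕜 := ℝ) i).comp (fderiv ℝ v x)) (Pi.single i 1) := by
      rw [← integral_indicator measurableSet_Icc]
      congr 1; ext x
      by_cases hx : x ∈ Set.Icc a b <;> simp [hx, divergence]
    have hd : ∀ x, HasFDerivAt v (fderiv ℝ v x) x := fun x =>
      ((hv.contDiff.differentiable (by norm_num)) x).hasFDerivAt
    rw [h1, integral_divergence_of_hasFDerivAt_off_countable' a b hab (fun i x => v x i)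
      (fun i x => (EuclideanSpace.proj (𝕜 := ℝ) i).comp (fderiv ℝ v x)) ∅ Set.countable_empty
      (fun i =>
        ((EuclideanSpace.proj (𝕜 := ℝ) i).continuous.comp hv.contDiff.continuous).continuousOn)
      (fun x _ i => (EuclideanSpace.proj (𝕜 := ℝ) i).hasFDerivAt.comp x (hd x))
      (by
        have : (fun x => ∑ i, ((EuclideanSpace.proj (𝕜 := ℝ) i).comp (fderiv ℝ v x))
            (Pi.single i 1)) = divergence v := by
          ext x; simp [divergence]
        rw [this]
        exact hv.continuous_divergence.continuousOn.integrableOn_compact isCompact_Icc)]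
    refine (Finset.sum_le_card_nsmul _ _ 2 fun i _ => ?_).trans (by simp [mul_comm])
    have hb' : ∀ y, ‖v y i‖ ≤ 1 := fun y => (PiLp.norm_apply_le (v y) i).trans (hv.norm_le_one y)
    have hvol : volume.real (Set.Icc (a ∘ i.succAbove) (b ∘ i.succAbove)) ≤ 1 := by
      rw [Measure.real, Real.volume_Icc_pi_toReal (a := a ∘ i.succAbove) (b := b ∘ i.succAbove)
        fun j => hab _]
      refine Finset.prod_le_one (fun j _ => sub_nonneg.2 (hab _)) fun j _ => ?_
      have e1 := ha.1 (i.succAbove j)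
      have e2 := hb.2 (i.succAbove j)
      simp only [Pi.zero_apply, Pi.one_apply, Function.comp_apply] at e1 e2 ⊢
      linarith
    have hf : ∀ g : (Fin n → ℝ) → Fin (n + 1) → ℝ,
        |∫ x in Set.Icc (a ∘ i.succAbove) (b ∘ i.succAbove), v (g x) i| ≤ 1 := fun g => by
      have := norm_setIntegral_le_of_norm_le_const (μ := volume)
        (s := Set.Icc (a ∘ i.succAbove) (b ∘ i.succAbove)) (f := fun x => v (g x) i) (C := 1)
        isCompact_Icc.measure_lt_top (fun x _ => hb' _)
      rw [Real.norm_eq_abs, one_mul] at this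
      exact this.trans hvol
    have e1 := abs_le.1 (hf (i.insertNth (α := fun _ => ℝ) (b i)))
    have e2 := abs_le.1 (hf (i.insertNth (α := fun _ => ℝ) (a i)))
    linarith [e1.2, e2.1]

/-- A rectangle in `[0,1]^d` as a `BV`-set. -/
def rect {d : ℕ} (a b : cube d) (hab : a ≤ b) : BVSet d where
  carrier := Set.Icc (a : Fin d → ℝ) b
  subset_cube := Set.Icc_subset_Icc a.2.1 b.2.2
  nullMeasurable := measurableSet_Icc.nullMeasurableSet
  perimeter_lt_top := perimeter_Icc_lt_top _ _ hab

theorem stepSum_indicator_Icc {d : ℕ} (f : cube d → ℝ) (n : ℕ) {p q : Fin d → ℕ} (hpq : p ≤ q)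
    (hq : ∀ i, q i ≤ 2 ^ n) :
    stepSum f n ((Set.Icc (gridPt n p : Fin d → ℝ) (gridPt n q)).indicator fun _ => 1)
      = increment f (gridPt n p) (gridPt n q) := by
  have h2 : (0 : ℝ) < 2 ^ n := by positivity
  set B := Set.pi Set.univ fun i =>
    Set.Ico ((gridPt n p : Fin d → ℝ) i) ((gridPt n q : Fin d → ℝ) i) with hB
  set S := Fintype.piFinset (fun i => Finset.Ico (p i) (q i)) with hS
  have hae : B =ᵐ[volume] Set.Icc (gridPt n p : Fin d → ℝ) (gridPt n q) :=
    Measure.univ_pi_Ico_ae_eq_Icc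
  rw [stepSum_congr f n (indicator_ae_eq_of_ae_eq_set hae).symm, ← sum_cellIncr f n hpq, stepSum]
  -- With half-open boxes, each cell lies either inside `B` or outside it.
  have hmem : ∀ k, ∀ x ∈ cell n k, x ∈ B ↔ k ∈ S := by
    intro k x hx
    rw [hB, hS, Fintype.mem_piFinset, Set.mem_univ_pi]
    refine forall_congr' fun i => ?_
    have hk := mem_cell.1 hx i
    rw [gridPt_apply hq, gridPt_apply fun i => (hpq i).trans (hq i), Set.mem_Ico, Finset.mem_Ico,
      div_le_iff₀ h2, lt_div_iff₀ h2, mul_comm (x i)]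
    have e1 : (p i : ℝ) ≤ 2 ^ n * x i ↔ (p i : ℤ) ≤ k i := by
      rw [← hk, Int.le_floor]; norm_cast
    have e2 : 2 ^ n * x i < (q i : ℝ) ↔ (k i : ℤ) < q i := by
      rw [← hk, Int.floor_lt]; norm_cast
    rw [e1, e2]
    norm_cast
  have hint : ∀ k, ∫ x in cell n k, B.indicator (fun _ => (1 : ℝ)) x
      = if k ∈ S then (2 ^ (n * d) : ℝ)⁻¹ else 0 := by
    intro k
    rw [setIntegral_congr_fun (g := fun _ => if k ∈ S then (1 : ℝ) else 0)
      (measurableSet_cell n k) fun x hx => ?_]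
    · rw [setIntegral_const, volume_cell]; simp
    · by_cases hk : k ∈ S
      · simp [hk, (hmem k x hx).2 hk]
      · simp [hk, (hmem k x hx).not.2 hk]
  simp only [hint, mul_ite, mul_zero]
  rw [← Finset.sum_filter, Finset.filter_mem_eq_inter, Finset.inter_eq_right.2]
  · exact Finset.sum_congr rfl fun k _ => by field_simp
  · intro k hk
    refine mem_grid.2 fun i => ?_
    exact (Finset.mem_Ico.1 (Fintype.mem_piFinset.1 hk i)).2.trans_le (hq i)

theorem gridPt_mono {d n : ℕ} {p q : Fin d → ℕ} (hpq : p ≤ q) : gridPt n p ≤ gridPt n q :=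
  fun i => min_le_min_right _ (by gcongr; exact hpq i)

/-- A dyadic rectangle of generation `n` is also one of generation `n + m`, so the step functionals
take the exact value on it from generation `n` on. -/
theorem apply_rect_gridPt {d : ℕ} {f : cube d → ℝ} {α : StrongDual ℝ (BVCube d)}
    (hα : Filter.Tendsto (stepDual f) Filter.atTop (𝓝 α)) (n : ℕ) {p q : Fin d → ℕ} (hpq : p ≤ q)
    (hq : ∀ i, q i ≤ 2 ^ n) :
    α (rect _ _ (gridPt_mono hpq : gridPt n p ≤ gridPt n q)).ind
      = increment f (gridPt n p) (gridPt n q) := by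
  have h1 := (((ContinuousLinearMap.apply ℝ ℝ
    (rect _ _ (gridPt_mono hpq : gridPt n p ≤ gridPt n q)).ind).continuous.tendsto α).comp hα).comp
      (Filter.tendsto_add_atTop_nat n)
  refine tendsto_nhds_unique h1 (tendsto_const_nhds.congr fun m => ?_)
  rw [Function.comp_apply, Function.comp_apply, ContinuousLinearMap.apply_apply, stepDual_apply,
    stepSum_congr f _ (BVSet.ind_ae_eq _), add_comm m n]
  dsimp only [rect]
  rw [← gridPt_add n m p, ← gridPt_add n m q]
  refine (stepSum_indicator_Icc f (n + m) (fun i => Nat.mul_le_mul_left _ (hpq i)) fun i => ?_).symm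
  rw [pow_add, mul_comm]
  exact Nat.mul_le_mul_right _ (hq i)

theorem continuous_increment {d : ℕ} {f : cube d → ℝ} (hf : Continuous f) :
    Continuous fun ab : cube d × cube d => increment f ab.1 ab.2 := by
  refine continuous_finsetSum _ fun s _ => continuous_const.mul (hf.comp ?_)
  refine Continuous.subtype_mk (continuous_pi fun i => ?_) _
  by_cases hi : i ∈ s
  · simp only [Finset.piecewise_eq_of_mem _ _ _ hi]
    exact (continuous_apply i).comp (continuous_subtype_val.comp continuous_fst)
  · simp only [Finset.piecewise_eq_of_notMem _ _ _ hi]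
    exact (continuous_apply i).comp (continuous_subtype_val.comp continuous_snd)

/-- The largest index `k` with `k / 2^n ≤ a`. -/
def lowerIndex {d : ℕ} (n : ℕ) (a : cube d) (i : Fin d) : ℕ := ⌊(a : Fin d → ℝ) i * 2 ^ n⌋₊

theorem lowerIndex_mono {d : ℕ} (n : ℕ) {a b : cube d} (hab : a ≤ b) :
    lowerIndex n a ≤ lowerIndex n b :=
  fun i => Nat.floor_mono (by gcongr; exact hab i)

theorem lowerIndex_le {d : ℕ} (n : ℕ) (a : cube d) (i : Fin d) : lowerIndex n a i ≤ 2 ^ n := by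
  refine Nat.floor_le_of_le ?_
  push_cast
  exact mul_le_of_le_one_left (by positivity) (a.2.2 i)

theorem tendsto_gridPt_lowerIndex {d : ℕ} (a : cube d) :
    Filter.Tendsto (fun n => gridPt n (lowerIndex n a)) Filter.atTop (𝓝 a) := by
  rw [tendsto_subtype_rng, tendsto_pi_nhds]
  intro i
  simp only [gridPt_apply (lowerIndex_le _ a)]
  exact (tendsto_nat_floor_mul_div_atTop (a.2.1 i)).comp
    (tendsto_pow_atTop_atTop_of_one_lt (one_lt_two (α := ℝ)))

/-- Off the null set of points sharing a coordinate with `a'` or `b'`, membership in the rectangles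
is eventually constant; dominated convergence on the unit cube concludes. -/
theorem tendsto_volume_symmDiff_Icc {d : ℕ} {a b : ℕ → cube d} {a' b' : cube d}
    (ha : Filter.Tendsto a Filter.atTop (𝓝 a')) (hb : Filter.Tendsto b Filter.atTop (𝓝 b')) :
    Filter.Tendsto (fun n => volume (symmDiff (Set.Icc (a n : Fin d → ℝ) (b n)) (Set.Icc a' b')))
      Filter.atTop (𝓝 0) := by
  rw [tendsto_subtype_rng, tendsto_pi_nhds] at ha hb
  have hae : ∀ c : Fin d → ℝ, ∀ᵐ x : Fin d → ℝ, ∀ i, x i ≠ c i := fun c =>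
    ae_all_iff.2 fun i => Measure.ae_eval_ne (fun _ : Fin d => (volume : Measure ℝ)) i (c i)
  have := tendsto_measure_of_ae_tendsto_indicator (μ := (volume : Measure (Fin d → ℝ)))
    Filter.atTop (A := ∅)
    (As := fun n => symmDiff (Set.Icc (a n : Fin d → ℝ) (b n)) (Set.Icc a' b'))
    MeasurableSet.empty (fun n => measurableSet_Icc.symmDiff measurableSet_Icc)
    (B := cube d) measurableSet_Icc isCompact_Icc.measure_lt_top.ne
    (.of_forall fun n => Set.symmDiff_subset_union.trans (Set.union_subset
      (Set.Icc_subset_Icc (a n).2.1 (b n).2.2) (Set.Icc_subset_Icc a'.2.1 b'.2.2))) ?_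
  · simpa using this
  filter_upwards [hae a', hae b'] with x hxa hxb
  have h1 : ∀ᶠ n in Filter.atTop, ∀ i, ((a n : Fin d → ℝ) i ≤ x i ↔ (a' : Fin d → ℝ) i ≤ x i) ∧
      (x i ≤ (b n : Fin d → ℝ) i ↔ x i ≤ (b' : Fin d → ℝ) i) := by
    refine Filter.eventually_all.2 fun i => Filter.Eventually.and ?_ ?_
    · rcases (hxa i).lt_or_gt with h | h
      · filter_upwards [(ha i).eventually_const_lt h] with n hn
        exact iff_of_false hn.not_ge h.not_ge
      · filter_upwards [(ha i).eventually_lt_const h] with n hn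
        exact iff_of_true hn.le h.le
    · rcases (hxb i).lt_or_gt with h | h
      · filter_upwards [(hb i).eventually_const_lt h] with n hn
        exact iff_of_true hn.le h.le
      · filter_upwards [(hb i).eventually_lt_const h] with n hn
        exact iff_of_false hn.not_ge h.not_ge
  filter_upwards [h1] with n hn
  have : x ∈ Set.Icc (a n : Fin d → ℝ) (b n) ↔ x ∈ Set.Icc (a' : Fin d → ℝ) b' := by
    simp only [Set.mem_Icc, Pi.le_def]
    exact and_congr (forall_congr' fun i => (hn i).1) (forall_congr' fun i => (hn i).2)
  simp only [Set.mem_symmDiff, this, Set.mem_empty_iff_false]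
  tauto

/-- Approximation by dyadic rectangles: the left side converges by continuity of the charge, the
right side by continuity of `f`. -/
theorem apply_rect {d : ℕ} {f : cube d → ℝ} (hf : Continuous f) {α : StrongDual ℝ (BVCube d)}
    (hα : Filter.Tendsto (stepDual f) Filter.atTop (𝓝 α)) (a b : cube d) (hab : a ≤ b) :
    α (rect a b hab).ind = increment f a b := by
  have ha := tendsto_gridPt_lowerIndex a
  have hb := tendsto_gridPt_lowerIndex b
  have h1 := (isCharge_of_tendsto_stepDual hα).tendsto
    (fun n => rect _ _ (gridPt_mono (lowerIndex_mono n hab) :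
      gridPt n (lowerIndex n a) ≤ gridPt n (lowerIndex n b))) (rect a b hab)
    ((iSup_le fun n => perimeter_Icc_le (Subtype.coe_prop _) (Subtype.coe_prop _)
      (gridPt_mono (lowerIndex_mono n hab))).trans_lt ENNReal.ofReal_lt_top)
    (tendsto_volume_symmDiff_Icc ha hb)
  have h2 := ((continuous_increment hf).tendsto (a, b)).comp (ha.prodMk_nhds hb)
  refine tendsto_nhds_unique h1 (h2.congr fun n => ?_)
  exact (apply_rect_gridPt hα n (lowerIndex_mono n hab) (lowerIndex_le n b)).symm

theorem extendsIncrement_of_tendsto_stepDual {d : ℕ} {f : cube d → ℝ} (hf : Continuous f)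
    {α : StrongDual ℝ (BVCube d)} (hα : Filter.Tendsto (stepDual f) Filter.atTop (𝓝 α)) :
    ExtendsIncrement f fun B : BVSet d => α B.ind := by
  intro m a b hab hdisj F hF
  have hab' : ∀ j, a j ≤ b j := fun j i => (hab j i).le
  dsimp only
  rw [BVSet.ind_eq_sum (fun j => rect (a j) (b j) (hab' j)) F hF hdisj, map_sum]
  exact Finset.sum_congr rfl fun j _ => apply_rect hf hα _ _ _

/-- A continuous function whose increments on dyadic cubes decay fast enough is strongly
chargeable. -/
theorem exists_isStrongCharge {d : ℕ} {f : cube d → ℝ} (hf : Continuous f) {C ρ : ℝ} (hC : 0 ≤ C)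
    (hρ : 0 ≤ ρ) (hρ2 : ρ < 2)
    (h : ∀ n, ∀ k ∈ grid d n, 2 ^ (n * d) * |cellIncr f n k| ≤ C * ρ ^ n) :
    ∃ μ : BVSet d → ℝ, IsStrongCharge μ ∧ ExtendsIncrement f μ := by
  obtain ⟨α, hα, hlim⟩ := exists_tendsto_stepDual hC hρ hρ2 h
  exact ⟨fun B => α B.ind, ⟨isCharge_of_tendsto_stepDual hlim, α, hα, fun _ => rfl⟩,
    extendsIncrement_of_tendsto_stepDual hf hlim⟩

/-! ### Gaussian estimates -/

/-- The law of `X` is that of `σ` times a standard Gaussian variable. -/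
theorem lintegral_enorm_pow_of_hasGaussianLaw {Ω : Type*} [MeasurableSpace Ω] {P : Measure Ω}
    {X : Ω → ℝ} (hX : HasGaussianLaw X P) (h0 : ∫ ω, X ω ∂P = 0) {σ : ℝ}
    (h2 : ∫ ω, X ω ^ 2 ∂P = σ ^ 2) (p : ℕ) :
    ∫⁻ ω, ‖X ω‖ₑ ^ p ∂P = ‖σ‖ₑ ^ p * ∫⁻ x, ‖x‖ₑ ^ p ∂(gaussianReal 0 1) := by
  have hP := hX.isProbabilityMeasure
  have hvar : Var[X; P] = σ ^ 2 := by
    rw [variance_of_integral_eq_zero hX.aemeasurable h0]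
    exact h2
  have hmap : P.map X = (gaussianReal 0 1).map (σ * ·) := by
    rw [hX.map_eq_gaussianReal, h0, gaussianReal_map_const_mul, hvar, mul_zero, mul_one]
    congr 1
    exact Real.toNNReal_of_nonneg (sq_nonneg σ)
  have hm : Measurable fun x : ℝ => ‖x‖ₑ ^ p := by fun_prop
  rw [← lintegral_map' (f := fun x : ℝ => ‖x‖ₑ ^ p) hm.aemeasurable hX.aemeasurable, hmap,
    lintegral_map hm (by fun_prop), ← lintegral_const_mul _ hm]
  simp only [enorm_mul, mul_pow]

theorem lintegral_enorm_pow_gaussianReal_lt_top (p : ℕ) :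
    ∫⁻ x, ‖x‖ₑ ^ p ∂(gaussianReal 0 1) < ∞ := by
  rcases eq_or_ne p 0 with rfl | hp
  · simp
  have h := memLp_id_gaussianReal (μ := 0) (v := 1) p
  have := lintegral_rpow_enorm_lt_top_of_eLpNorm_lt_top (by simpa using hp) (by simp) h.2
  simpa using this

/-- Borel–Cantelli type bound for Gaussian variables indexed by dyadic cubes. -/
theorem ae_exists_bound_of_hasGaussianLaw {d : ℕ} {Ω : Type*} [MeasurableSpace Ω] {P : Measure Ω}
    {Y : ℕ → (Fin d → ℕ) → Ω → ℝ} {q : ℝ} (hq0 : 0 ≤ q) (hq1 : q < 1)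
    (hG : ∀ n, ∀ k ∈ grid d n, HasGaussianLaw (Y n k) P)
    (hmean : ∀ n, ∀ k ∈ grid d n, ∫ ω, Y n k ω ∂P = 0)
    (hvar : ∀ n, ∀ k ∈ grid d n, ∫ ω, Y n k ω ^ 2 ∂P = (q ^ n) ^ 2) :
    ∀ᵐ ω ∂P, ∃ C : ℝ, 0 ≤ C ∧ ∀ n, ∀ k ∈ grid d n, |Y n k ω| ≤ C := by
  -- The moment `p` is chosen so that `2^d q^p < 1`: the decay `q^{np}` of the moments then beats
  -- the number `2^{nd}` of cubes, and the sum of all `p`-th powers has finite expectation.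
  obtain ⟨p, hp⟩ := exists_pow_lt_of_lt_one (by positivity : (0 : ℝ) < (2 ^ d)⁻¹) hq1
  have hp0 : p ≠ 0 := by
    rintro rfl
    rw [pow_zero] at hp
    exact absurd hp (not_lt.2 (inv_le_one_of_one_le₀ (one_le_pow₀ one_le_two)))
  set M := ∫⁻ x, ‖x‖ₑ ^ p ∂(gaussianReal 0 1) with hM
  set r : ℝ≥0∞ := 2 ^ d * ENNReal.ofReal (q ^ p) with hr
  have hr1 : r < 1 := by
    have h1 : (2 : ℝ) ^ d * q ^ p < 1 := by
      have := mul_lt_mul_of_pos_left hp (by positivity : (0 : ℝ) < 2 ^ d)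
      rwa [mul_inv_cancel₀ (by positivity)] at this
    have h2 : r = ENNReal.ofReal (2 ^ d * q ^ p) := by
      rw [ENNReal.ofReal_mul (by positivity), ENNReal.ofReal_pow (by positivity)]
      simp [hr]
    rw [h2, ENNReal.ofReal_lt_one]
    exact h1
  have hmeas : ∀ n, AEMeasurable (fun ω => ∑ k ∈ grid d n, ‖Y n k ω‖ₑ ^ p) P := fun n =>
    Finset.aemeasurable_fun_sum _ fun k hk => ((hG n k hk).aemeasurable.enorm).pow_const p
  have hlint : ∫⁻ ω, ∑' n, ∑ k ∈ grid d n, ‖Y n k ω‖ₑ ^ p ∂P = (∑' n : ℕ, r ^ n) * M := by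
    rw [lintegral_tsum hmeas, ← ENNReal.tsum_mul_right]
    refine tsum_congr fun n => ?_
    rw [lintegral_finsetSum' _ fun k hk => ((hG n k hk).aemeasurable.enorm).pow_const p]
    rw [Finset.sum_congr rfl fun k hk => lintegral_enorm_pow_of_hasGaussianLaw (hG n k hk)
      (hmean n k hk) (hvar n k hk) p, Finset.sum_const]
    have hcard : (grid d n).card = (2 ^ d) ^ n := by
      simp [grid, ← pow_mul, mul_comm]
    rw [hcard, nsmul_eq_mul, ← mul_assoc, hr, mul_pow, Real.enorm_of_nonneg (by positivity),
      ← ENNReal.ofReal_pow (by positivity), ← ENNReal.ofReal_pow (by positivity), pow_right_comm q n p]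
    push_cast
    rfl
  have hfin : ∫⁻ ω, ∑' n, ∑ k ∈ grid d n, ‖Y n k ω‖ₑ ^ p ∂P ≠ ∞ := by
    rw [hlint, ENNReal.tsum_geometric]
    refine ENNReal.mul_ne_top ?_ (lintegral_enorm_pow_gaussianReal_lt_top p).ne
    exact ENNReal.inv_ne_top.2 (tsub_pos_of_lt hr1).ne'
  filter_upwards [ae_lt_top' (AEMeasurable.tsum hmeas) hfin] with ω hω
  set Z := ∑' n, ∑ k ∈ grid d n, ‖Y n k ω‖ₑ ^ p
  -- The sum `Z` dominates `|Y|^p`, which dominates `|Y|` only when `|Y| ≥ 1`.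
  refine ⟨max 1 Z.toReal, by positivity, fun n k hk => ?_⟩
  rcases le_total |Y n k ω| 1 with h | h
  · exact h.trans (le_max_left _ _)
  refine le_trans ?_ (le_max_right _ _)
  have h1 : ‖Y n k ω‖ₑ ^ p ≤ Z :=
    (Finset.single_le_sum (f := fun k => ‖Y n k ω‖ₑ ^ p) (fun _ _ => zero_le) hk).trans
      (ENNReal.le_tsum n)
  have h2 := ENNReal.toReal_mono hω.ne h1
  rw [ENNReal.toReal_pow, toReal_enorm, Real.norm_eq_abs] at h2
  exact (le_self_pow₀ h hp0).trans h2

/-! ### The fractional Brownian sheet -/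

theorem phi_self {h : ℝ} (hh : h ≠ 0) (t : ℝ) : phi h t t = |t| ^ (2 * h) := by
  rw [phi, sub_self, abs_zero, Real.zero_rpow (by simpa using hh)]
  ring

/-- The terms of `phi` that depend on one variable cancel in a mixed increment; only the
off-diagonal terms `|b - a|^{2h} / 2` survive, twice. -/
theorem phi_increment {h : ℝ} (hh : h ≠ 0) (a b : ℝ) :
    (phi h b b - phi h b a) - (phi h a b - phi h a a) = |b - a| ^ (2 * h) := by
  rw [phi_self hh, phi_self hh, phi, phi, abs_sub_comm a b]
  ring

namespace IsFractionalBrownianSheet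

variable {d : ℕ} {Ω : Type*} [MeasurableSpace Ω] {P : Measure Ω} {H : Fin d → ℝ}
  {W : cube d → Ω → ℝ}

theorem memLp_two (hW : IsFractionalBrownianSheet H W P) (t : cube d) : MemLp (W t) 2 P :=
  (hW.gaussian.hasGaussianLaw_eval t).memLp_two

theorem hasGaussianLaw_increment (hW : IsFractionalBrownianSheet H W P) (a b : cube d) :
    HasGaussianLaw (fun ω => increment (fun t => W t ω) a b) P :=
  ((hW.gaussian.comp_right (vertex a b)).smul fun s : Finset (Fin d) => (-1) ^ s.card).hasGaussianLaw_fun_sum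
    (I := Finset.univ)

theorem integral_increment (hW : IsFractionalBrownianSheet H W P) (a b : cube d) :
    ∫ ω, increment (fun t => W t ω) a b ∂P = 0 := by
  simp only [increment]
  rw [integral_finsetSum _ fun s _ =>
    ((hW.gaussian.hasGaussianLaw_eval (vertex a b s)).integrable).const_mul _]
  simp [integral_const_mul, hW.centered]

/-- The covariance is a product over coordinates, so the rectangular increment factorizes. Applied
in each of the two variables, this leaves a product of one-dimensional mixed increments. -/
theorem integral_increment_sq (hW : IsFractionalBrownianSheet H W P)
    (hH : ∀ i, H i ≠ 0) (a b : cube d) :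
    ∫ ω, increment (fun t => W t ω) a b ^ 2 ∂P
      = ∏ i, |(b : Fin d → ℝ) i - (a : Fin d → ℝ) i| ^ (2 * H i) := by
  have hint : ∀ t t' : cube d, Integrable (fun ω => W t ω * W t' ω) P := fun t t' =>
    (hW.memLp_two t).integrable_mul (hW.memLp_two t')
  have h1 : ∀ ω, increment (fun t => W t ω) a b ^ 2 = ∑ s : Finset (Fin d), ∑ s' : Finset (Fin d),
      (-1) ^ s.card * ((-1) ^ s'.card * (W (vertex a b s) ω * W (vertex a b s') ω)) := fun ω => by
    rw [increment, sq, Finset.sum_mul_sum]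
    exact Finset.sum_congr rfl fun s _ => Finset.sum_congr rfl fun s' _ => by ring
  simp_rw [h1]
  rw [integral_finsetSum _ fun s _ => integrable_finsetSum _ fun s' _ =>
    ((hint _ _).const_mul _).const_mul _]
  have h2 : ∀ s : Finset (Fin d), ∫ ω, ∑ s' : Finset (Fin d),
      (-1) ^ s.card * ((-1) ^ s'.card * (W (vertex a b s) ω * W (vertex a b s') ω)) ∂P
      = (-1) ^ s.card * ∏ i, (phi (H i) (s.piecewise (a : Fin d → ℝ) b i) ((b : Fin d → ℝ) i)
        - phi (H i) (s.piecewise (a : Fin d → ℝ) b i) ((a : Fin d → ℝ) i)) := fun s => by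
    rw [integral_finsetSum _ fun s' _ => ((hint _ _).const_mul _).const_mul _]
    simp only [integral_const_mul, hW.covariance]
    rw [← Finset.mul_sum]
    congr 1
    exact sum_neg_one_pow_card_mul_prod
      (fun i t => phi (H i) (s.piecewise (a : Fin d → ℝ) b i) t) _ _
  rw [Finset.sum_congr rfl fun s _ => h2 s, sum_neg_one_pow_card_mul_prod
    (fun i t => phi (H i) t ((b : Fin d → ℝ) i) - phi (H i) t ((a : Fin d → ℝ) i))]
  exact Finset.prod_congr rfl fun i _ => phi_increment (hH i) _ _

theorem integral_cellIncr_sq (hW : IsFractionalBrownianSheet H W P) (hH : ∀ i, H i ≠ 0) {n : ℕ}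
    {k : Fin d → ℕ} (hk : k ∈ grid d n) :
    ∫ ω, cellIncr (fun t => W t ω) n k ^ 2 ∂P = (((2 : ℝ) ^ (-∑ i, H i)) ^ n) ^ 2 := by
  have hk1 : ∀ i, k i ≤ 2 ^ n := fun i => (mem_grid.1 hk i).le
  have hk2 : ∀ i, (k + 1) i ≤ 2 ^ n := fun i => mem_grid.1 hk i
  simp only [cellIncr]
  rw [hW.integral_increment_sq hH]
  have h1 : ∀ i, |(gridPt n (k + 1) : Fin d → ℝ) i - (gridPt n k : Fin d → ℝ) i| ^ (2 * H i)
      = (2 : ℝ) ^ (-(n * 2 * H i)) := fun i => by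
    rw [gridPt_apply hk1, gridPt_apply hk2, ← sub_div]
    simp only [Pi.add_apply, Pi.one_apply, Nat.cast_add, Nat.cast_one, add_sub_cancel_left]
    rw [abs_of_pos (by positivity), one_div, ← Real.rpow_natCast, ← Real.rpow_neg zero_le_two,
      ← Real.rpow_mul zero_le_two]
    congr 1
    ring
  rw [Finset.prod_congr rfl fun i _ => h1 i, ← Real.rpow_sum_of_pos two_pos, ← Real.rpow_natCast,
    ← Real.rpow_natCast, ← Real.rpow_mul zero_le_two, ← Real.rpow_mul zero_le_two]
  congr 1
  rw [Finset.sum_neg_distrib, ← Finset.mul_sum]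
  push_cast
  ring

/-- After rescaling by `2^{sn}`, the increments of generation `n` have standard deviation `q^n` with
`q = 2^{s - ∑ H_i} < 1`. -/
theorem ae_cellIncr_le (hW : IsFractionalBrownianSheet H W P) (hH : ∀ i, H i ≠ 0) {s : ℝ}
    (hs : s < ∑ i, H i) :
    ∀ᵐ ω ∂P, ∃ C : ℝ, 0 ≤ C ∧ ∀ n, ∀ k ∈ grid d n,
      ((2 : ℝ) ^ s) ^ n * |cellIncr (fun t => W t ω) n k| ≤ C := by
  have hq : (2 : ℝ) ^ s * (2 : ℝ) ^ (-∑ i, H i) < 1 := by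
    rw [← Real.rpow_add two_pos]
    exact Real.rpow_lt_one_of_one_lt_of_neg one_lt_two (by linarith)
  have := ae_exists_bound_of_hasGaussianLaw (P := P)
    (Y := fun n (k : Fin d → ℕ) ω => ((2 : ℝ) ^ s) ^ n * cellIncr (fun t => W t ω) n k)
    (q := (2 : ℝ) ^ s * (2 : ℝ) ^ (-∑ i, H i)) (by positivity) hq
    (fun n k _ => (hW.hasGaussianLaw_increment _ _).fun_smul _)
    (fun n k _ => by
      rw [integral_const_mul]
      simp only [cellIncr]
      rw [hW.integral_increment, mul_zero])
    (fun n k hk => by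
      simp only [mul_pow _ (cellIncr _ _ _)]
      rw [integral_const_mul, hW.integral_cellIncr_sq hH hk]
      ring)
  filter_upwards [this] with ω ⟨C, hC, h⟩
  refine ⟨C, hC, fun n k hk => ?_⟩
  have := h n k hk
  rwa [abs_mul, abs_of_pos (by positivity)] at this

theorem ae_eq_zero (hW : IsFractionalBrownianSheet H W P) (hH : ∀ i, H i ≠ 0) {t : cube d}
    {i : Fin d} (hi : (t : Fin d → ℝ) i = 0) : ∀ᵐ ω ∂P, W t ω = 0 := by
  have h0 : ∫ ω, W t ω ^ 2 ∂P = 0 := by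
    simp only [sq]
    rw [hW.covariance]
    refine Finset.prod_eq_zero (Finset.mem_univ i) ?_
    rw [hi, phi_self (hH i), abs_zero, Real.zero_rpow (by simpa using hH i)]
  have h1 := (integral_eq_zero_iff_of_nonneg (fun ω => sq_nonneg (W t ω))
    (hW.memLp_two t).integrable_sq).1 h0
  filter_upwards [h1] with ω hω
  simpa using hω

/-- Zero variance gives vanishing at one point at a time, with a null set depending on the point. A
countable dense subset of each face and continuity give the whole face at once. -/
theorem ae_isC0 (hW : IsFractionalBrownianSheet H W P) (hH : ∀ i, H i ≠ 0)
    (hcont : ∀ᵐ ω ∂P, Continuous fun t => W t ω) : ∀ᵐ ω ∂P, IsC0 fun t => W t ω := by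
  have h : ∀ i, ∀ᵐ ω ∂P, (Continuous fun t => W t ω) →
      ∀ t : cube d, (t : Fin d → ℝ) i = 0 → W t ω = 0 := by
    intro i
    obtain ⟨D, hDc, hD⟩ := TopologicalSpace.exists_countable_dense
      {t : cube d // (t : Fin d → ℝ) i = 0}
    have h1 : ∀ᵐ ω ∂P, ∀ t ∈ D, W t ω = 0 :=
      (ae_ball_iff hDc).2 fun t _ => hW.ae_eq_zero hH t.2
    filter_upwards [h1] with ω hω hc t ht
    exact congrFun (Continuous.ext_on hD (hc.comp continuous_subtype_val) continuous_const
      fun t ht => hω t ht) ⟨t, ht⟩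
  filter_upwards [ae_all_iff.2 h, hcont] with ω hω hc
  exact ⟨hc, fun t ⟨i, hi⟩ => hω i hc t hi⟩

end IsFractionalBrownianSheet

/-! ### Hölder property -/

/-- A dyadic cube is a figure with a single rectangle, and `|K|^γ = 2^{-ndγ}`. -/
theorem isHolderOnDyadic_of_extendsIncrement {d : ℕ} {f : cube d → ℝ} {μ : BVSet d → ℝ}
    (hμ : ExtendsIncrement f μ) {C γ : ℝ} (hC : 0 ≤ C)
    (h : ∀ n, ∀ k ∈ grid d n, ((2 : ℝ) ^ (d * γ)) ^ n * |cellIncr f n k| ≤ C) :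
    IsHolderOnDyadic γ μ := by
  refine ⟨C, hC, ?_⟩
  rintro K ⟨n, k, hk, hK⟩
  have hkg : k ∈ grid d n := mem_grid.2 hk
  have e1 : (gridPt n k : Fin d → ℝ) = fun i => (k i : ℝ) / 2 ^ n :=
    funext fun i => gridPt_apply (fun i => (hk i).le) i
  have e2 : (gridPt n (k + 1) : Fin d → ℝ) = fun i => ((k i : ℝ) + 1) / 2 ^ n :=
    funext fun i => by
      rw [gridPt_apply (k := k + 1) fun i => hk i]
      simp
  have hKe : K.carrier = Set.Icc (gridPt n k : Fin d → ℝ) (gridPt n (k + 1)) := by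
    rw [hK, e1, e2]
  have hval : μ K = cellIncr f n k := by
    have := hμ 1 (fun _ => gridPt n k) (fun _ => gridPt n (k + 1))
      (fun _ i => by rw [e1, e2]; dsimp only; gcongr; linarith)
      (fun j l hjl => absurd (Subsingleton.elim j l) hjl) K
      (by rw [hKe, Set.iUnion_const])
    rw [this]
    simp [cellIncr]
  have hvol : (volume K.carrier).toReal = ((2 : ℝ) ^ (n * d))⁻¹ := by
    rw [hK, ← volume_cell n k, Measure.real, cell]
    exact congrArg _ (measure_congr Measure.univ_pi_Ico_ae_eq_Icc).symm
  have hpow : (((2 : ℝ) ^ (n * d))⁻¹) ^ γ = (((2 : ℝ) ^ (d * γ)) ^ n)⁻¹ := by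
    rw [Real.inv_rpow (by positivity), ← Real.rpow_natCast, ← Real.rpow_natCast,
      ← Real.rpow_mul zero_le_two, ← Real.rpow_mul zero_le_two]
    congr 2
    push_cast
    ring
  rw [hval, hvol, hpow, ← div_eq_mul_inv, le_div_iff₀ (by positivity), mul_comm]
  exact h n k hkg

end FBS

end

/-! ### Almost sure strong chargeability of the sheet -/

theorem mainTheorem1 {d : ℕ} (hd : 1 ≤ d) {Ω : Type*} [MeasurableSpace Ω]
    (P : Measure Ω) [IsProbabilityMeasure P] (H : Fin d → ℝ)
    (hH : ∀ i, H i ∈ Set.Ioo (0 : ℝ) 1) (W : FBS.cube d → Ω → ℝ)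
    (hW : FBS.IsFractionalBrownianSheet H W P)
    (hcont : ∀ᵐ ω ∂P, Continuous fun t => W t ω)
    (hmean : ((d : ℝ) - 1) / d < (∑ i, H i) / d) :
    ∀ᵐ ω ∂P, FBS.IsC0 (fun t => W t ω) ∧
      ∃ μ : FBS.BVSet d → ℝ, FBS.IsStrongCharge μ ∧
        FBS.ExtendsIncrement (fun t => W t ω) μ ∧
        ∀ γ : ℝ, 0 < γ → γ < (∑ i, H i) / d → FBS.IsHolderOnDyadic γ μ := by
  have hd0 : (0 : ℝ) < d := by exact_mod_cast hd
  have hH0 : ∀ i, H i ≠ 0 := fun i => (hH i).1.ne'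
  set S := ∑ i, H i with hS
  have hS1 : (d : ℝ) - 1 < S := (div_lt_div_iff_of_pos_right hd0).1 hmean
  -- Countably many exponents increasing to `S` suffice, so that one null set serves all `s < S` and
  -- hence all `γ`.
  have hall : ∀ᵐ ω ∂P, ∀ m : ℕ, ∃ C : ℝ, 0 ≤ C ∧ ∀ n, ∀ k ∈ FBS.grid d n,
      ((2 : ℝ) ^ (S - 1 / ((m : ℝ) + 1))) ^ n * |FBS.cellIncr (fun t => W t ω) n k| ≤ C :=
    ae_all_iff.2 fun m => hW.ae_cellIncr_le hH0 (sub_lt_self _ (by positivity))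
  filter_upwards [hall, hW.ae_isC0 hH0 hcont] with ω hω hC0
  have hbound : ∀ s < S, ∃ C : ℝ, 0 ≤ C ∧ ∀ n, ∀ k ∈ FBS.grid d n,
      ((2 : ℝ) ^ s) ^ n * |FBS.cellIncr (fun t => W t ω) n k| ≤ C := by
    intro s hs
    obtain ⟨m, hm⟩ := exists_nat_one_div_lt (sub_pos.2 hs)
    obtain ⟨C, hC, h⟩ := hω m
    refine ⟨C, hC, fun n k hk => le_trans ?_ (h n k hk)⟩
    gcongr
    · norm_num
    · linarith
  refine ⟨hC0, ?_⟩
  -- `s < S` gives the almost sure bound on increments, and `s > d - 1` gives `ρ = 2^{d-s} < 2`.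
  obtain ⟨s, hs1, hs2⟩ := exists_between hS1
  obtain ⟨C, hC, h⟩ := hbound s hs2
  obtain ⟨μ, hμ, hext⟩ := FBS.exists_isStrongCharge hC0.1 (ρ := (2 : ℝ) ^ (d - s)) hC (by positivity)
    (by
      conv_rhs => rw [← Real.rpow_one 2]
      exact Real.rpow_lt_rpow_of_exponent_lt one_lt_two (by linarith))
    (fun n k hk => by
      have h1 : (2 : ℝ) ^ (n * d) = ((2 : ℝ) ^ ((d : ℝ) - s)) ^ n * ((2 : ℝ) ^ s) ^ n := by
        rw [← mul_pow, ← Real.rpow_add two_pos, sub_add_cancel, Real.rpow_natCast, ← pow_mul,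
          mul_comm]
      rw [h1, mul_assoc, mul_comm C]
      exact mul_le_mul_of_nonneg_left (h n k hk) (by positivity))
  refine ⟨μ, hμ, hext, fun γ _ hγ => ?_⟩
  -- The exponent `dγ` is admissible because `γ < S / d`.
  obtain ⟨C', hC', h'⟩ := hbound (d * γ) (by rwa [lt_div_iff₀ hd0, mul_comm] at hγ)
  exact FBS.isHolderOnDyadic_of_extendsIncrement hext hC' h'
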